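/- Let $d\ge 2$. A convex body is a compact convex subset of $\mathbb{E}^d$ with non-empty interior; a plank $P$ is the closed set between two distinct parallel hyperplanes. For a hyperplane $H$, $w(K,H)$ denotes the distance between the two supporting hyperplanes of $K$ parallel to $H$ (with value $\infty$ if $K$ is unbounded in the direction normal to $H$). For a convex body $C$ put $w_C(K,H)=w(K,H)/w(C,H)$ and let $w_C(K)=\min_H w_C(K,H)$ be the minimal $C$-width of $K$; the $C$-width $w_C(P)$ of a plank $P$ is its width divided by the width of $C$ parallel to it. The $C$-inradius $r$ of $K$ is the largest $\rho>0$ such that a translate of $\rho C$ lies in $K$. For $0<\rho\le r$ let $K^{\rho C}$ be the union of all translates of $\rho C$ contained in $K$. For an integer $m\ge1$ the $m$-th successive $C$-inradius $r_C(K,m)$ is the unique $\rho\in(0,r]$ with $w_C(K^{\rho C})=m\rho$; the same definition is used when $K$ is a plank. If $K$ is sliced by hyperplanes $H_1,\dots,H_{n-1}$ ($n\ge 1$; the hyperplanes need not be distinct or meet $K$), the pieces are the closures of the connected components of $K\setminus\bigcup_i H_i$. **Theorem.** For each fixed $d\ge2$ the following statements about $\mathbb{E}^d$ are equivalent (hence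 so are the conjectures asserting them for all $d\ge2$): 1. If a convex body $C$ is covered by planks $P_1,\dots,P_n$, then $\sum_{i=1}^n w_C(P_i)\ge 1$. 2. If a convex body $C$ is sliced by $n-1$ hyperplanes, then some piece contains a translate of $\frac1n C$. 3. If a convex body $K$ is covered by planks $P_1,\dots,P_n$, then $\sum_{i=1}^n w_C(P_i)\ge w_C(K)$ for every convex body $C$. 4. For all convex bodies $K,C$ and all $n\ge1$, the minimum, over all ways to slice $K$ by $n-1$ hyperplanes, of the greatest $C$-inradius of the pieces is equal to $r_C(K,n)$. 5. For every $m\ge1$, $(5_m)$ holds, where $(5_m)$ says: if $K,C$ are convex bodies and $K$ is covered by planks $P_1,\dots,P_n$, then $\sum_{i=1}^n r_C(P_i,m)\ge r_C(K,m)$. 6. For every $m\ge1$, $(6_m)$ holds, where $(6_m)$ says: if $K,C$ are convex bodies and $K$ is covered by planks $P_1,\dots,P_n$, then $\sum_{i=1}^n w_C(P_i)\ge m\,r_C(K,m)$. 7. For every $m\ge1$, $(7_m)$ holds, where $(7_m)$ says: for all convex bodies $K,C$ and all $n\ge1$, the minimum, over all ways to slice $K$ by $n-1$ hyperplanes, of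 the greatest $m$-th successive $C$-inradius of the pieces is equal to $r_C(K,mn)$. Moreover, for every single $m\ge1$, $(5_m)$ and $(6_m)$ are equivalent, and $(5_m)$ implies $(7_m)$. -/

import Mathlib

open scoped ENNReal Pointwise

namespace PlankInradii

/-- Euclidean `d`-space. -/
abbrev E (d : ℕ) : Type := EuclideanSpace ℝ (Fin d)

/-- A convex body: a compact convex set with non-empty interior. -/
structure IsConvexBody {d : ℕ} (K : Set (E d)) : Prop where
  convex : Convex ℝ K
  isCompact : IsCompact K
  interior_nonempty : (interior K).Nonempty

/-- For a unit vector `u`, the width of `K` parallel to the hyperplanes with normal `u`: the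
length of the projection of `K` to the line spanned by `u`, i.e. the distance between the two
supporting hyperplanes of `K` with normal `u` (infinite if `K` is unbounded in direction `u`). -/
noncomputable def width {d : ℕ} (K : Set (E d)) (u : E d) : ℝ≥0∞ :=
  ⨆ x ∈ K, ⨆ y ∈ K, ENNReal.ofReal (inner ℝ u x - inner ℝ u y)

/-- The `C`-width of `K` parallel to the hyperplanes with unit normal `u`. -/
noncomputable def relWidth {d : ℕ} (C K : Set (E d)) (u : E d) : ℝ≥0∞ :=
  width K u / width C u

/-- The minimal `C`-width `w_C(K)` of `K`. -/
noncomputable def minRelWidth {d : ℕ} (C K : Set (E d)) : ℝ≥0∞ :=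
  ⨅ u : Metric.sphere (0 : E d) 1, relWidth C K u

/-- The `C`-inradius of `K`: the factor of the largest positive homothetic copy of `C`, a
translate of which is contained in `K`. -/
noncomputable def inradius {d : ℕ} (C K : Set (E d)) : ℝ :=
  sSup {ρ : ℝ | 0 < ρ ∧ ∃ t : E d, t +ᵥ ρ • C ⊆ K}

/-- The `ρC`-rounded body of `K`: the union of all translates of `ρC` contained in `K`. -/
def roundedBody {d : ℕ} (C K : Set (E d)) (ρ : ℝ) : Set (E d) :=
  ⋃ t ∈ {t : E d | t +ᵥ ρ • C ⊆ K}, t +ᵥ ρ • C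

/-- The `m`-th successive `C`-inradius `r_C(K, m)`: the `ρ` with `0 < ρ ≤ r`, `r` the
`C`-inradius of `K`, such that the minimal `C`-width of the `ρC`-rounded body is `m ρ`.
For convex bodies (and for planks) `K`, a convex body `C` and `m ≥ 1` there is exactly one such
`ρ`, so the supremum is that of a one-point set. -/
noncomputable def succInradius {d : ℕ} (C K : Set (E d)) (m : ℕ) : ℝ :=
  sSup {ρ : ℝ | 0 < ρ ∧ ρ ≤ inradius C K ∧
    minRelWidth C (roundedBody C K ρ) = ENNReal.ofReal ((m : ℝ) * ρ)}

/-- A plank, given by a unit normal and the two distinct levels of its boundary hyperplanes. -/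
structure Plank (d : ℕ) where
  normal : E d
  norm_normal : ‖normal‖ = 1
  lo : ℝ
  hi : ℝ
  lo_lt_hi : lo < hi

/-- The closed set of points of a plank. -/
def Plank.carrier {d : ℕ} (P : Plank d) : Set (E d) :=
  {x | P.lo ≤ inner ℝ P.normal x ∧ inner ℝ P.normal x ≤ P.hi}

/-- The `C`-width of a plank: its width divided by the width of `C` parallel to it. -/
noncomputable def Plank.relWidth {d : ℕ} (C : Set (E d)) (P : Plank d) : ℝ≥0∞ :=
  ENNReal.ofReal (P.hi - P.lo) / width C P.normal

/-- The hyperplane `{x | ⟪normal, x⟫ = offset}`. -/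
structure Hyperplane (d : ℕ) where
  normal : E d
  norm_normal : ‖normal‖ = 1
  offset : ℝ

/-- `Q` is one of the pieces into which the hyperplanes `H i` slice `K`: for some point `x` of `K`
that lies on none of the hyperplanes, `Q` consists of the points of `K` that lie, for each `i`, in
the same closed half-space of `H i` as `x`. -/
def IsPiece {d k : ℕ} (K : Set (E d)) (H : Fin k → Hyperplane d) (Q : Set (E d)) : Prop :=
  ∃ x ∈ K, (∀ i, inner ℝ (H i).normal x ≠ (H i).offset) ∧
    Q = {y ∈ K | ∀ i, 0 ≤ (inner ℝ (H i).normal x - (H i).offset) *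
      (inner ℝ (H i).normal y - (H i).offset)}

/-- Bang's affine plank conjecture in `E d`. -/
def BangConjecture (d : ℕ) : Prop :=
  ∀ C : Set (E d), IsConvexBody C →
    ∀ (n : ℕ) (P : Fin n → Plank d), C ⊆ ⋃ i, (P i).carrier →
      1 ≤ ∑ i, (P i).relWidth C

/-- The Alexander--Davenport conjecture in `E d`: if a convex body `C` is sliced by `n - 1`
hyperplanes, then some piece covers a translate of `(1 / n) C`. -/
def AlexanderDavenportConjecture (d : ℕ) : Prop :=
  ∀ C : Set (E d), IsConvexBody C →
    ∀ n : ℕ, 1 ≤ n → ∀ H : Fin (n - 1) → Hyperplane d,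
      ∃ Q, IsPiece C H Q ∧ ∃ t : E d, t +ᵥ (1 / (n : ℝ)) • C ⊆ Q

/-- The plank version with two bodies in `E d`. -/
def BodyPlankConjecture (d : ℕ) : Prop :=
  ∀ K : Set (E d), IsConvexBody K →
    ∀ (n : ℕ) (P : Fin n → Plank d), K ⊆ ⋃ i, (P i).carrier →
      ∀ C : Set (E d), IsConvexBody C → minRelWidth C K ≤ ∑ i, (P i).relWidth C

/-- The cutting version with two bodies in `E d`: the minimum, over all ways to slice `K` by `n - 1`
hyperplanes, of the greatest `C`-inradius of the pieces is `r_C(K, n)`. -/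
def BodyCutConjecture (d : ℕ) : Prop :=
  ∀ K C : Set (E d), IsConvexBody K → IsConvexBody C → ∀ n : ℕ, 1 ≤ n →
    IsLeast {ρ : ℝ | ∃ H : Fin (n - 1) → Hyperplane d,
        IsGreatest {r : ℝ | ∃ Q, IsPiece K H Q ∧ r = inradius C Q} ρ}
      (succInradius C K n)

/-- The plank version for `m`-th successive inradii in `E d`. -/
def SuccPlankConjecture (d m : ℕ) : Prop :=
  ∀ K C : Set (E d), IsConvexBody K → IsConvexBody C →
    ∀ (n : ℕ) (P : Fin n → Plank d), K ⊆ ⋃ i, (P i).carrier →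
      succInradius C K m ≤ ∑ i, succInradius C (P i).carrier m

/-- The plank version for `m`-th successive inradii in `E d`, phrased with `C`-widths of planks. -/
def SuccPlankWidthConjecture (d m : ℕ) : Prop :=
  ∀ K C : Set (E d), IsConvexBody K → IsConvexBody C →
    ∀ (n : ℕ) (P : Fin n → Plank d), K ⊆ ⋃ i, (P i).carrier →
      ENNReal.ofReal ((m : ℝ) * succInradius C K m) ≤ ∑ i, (P i).relWidth C

/-- The cutting version for `m`-th successive inradii in `E d`: the minimum, over all ways to slice
`K` by `n - 1` hyperplanes, of the greatest `m`-th successive `C`-inradius of the pieces is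
`r_C(K, m n)`. -/
def SuccCutConjecture (d m : ℕ) : Prop :=
  ∀ K C : Set (E d), IsConvexBody K → IsConvexBody C → ∀ n : ℕ, 1 ≤ n →
    IsLeast {ρ : ℝ | ∃ H : Fin (n - 1) → Hyperplane d,
        IsGreatest {r : ℝ | ∃ Q, IsPiece K H Q ∧ r = succInradius C Q m} ρ}
      (succInradius C K (m * n))

end PlankInradii

/-! Everything is read off the set `centers C K ρ` of vectors `t` with `t + ρC ⊆ K`. It is convex,
and the rounded body is its Minkowski sum with `ρC`. Widths are additive, so the rounded body has
minimal `C`-width `mρ` exactly when the centers have minimal `C`-width `(m - 1)ρ`. Since rounded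
bodies shrink as `ρ` grows, `r_C(K, m)` is the greatest `ρ` whose centers are at least `(m - 1)ρ`
times as wide as `C` in every direction.

The plank statements form a short cycle. Bang's statement for `K` passes to `C`-widths because
`w_C(P) ≥ w_C(K) w_K(P)`. Applied to the rounded body, this gives the bound `m r_C(K, m)`. Taking `K
= C`, where `r_C(C, m) ≥ 1/m`, leads back to Bang. For a plank, `r_C(P, m) = w_C(P)/m`.

From planks to cuts (`BangConjecture.exists_piece_le_succInradius`): for `s < r_C(K, mn)` a suitable
body `L` is moved inside `K` by vectors proportional to the points of `T = centers C K s`. The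
positions at which a hyperplane meets `L` form a plank, and the `n - 1` planks are too thin to cover
`T`; some translate of `L` therefore lies in a single piece. Equal slabs in a direction of minimal
width give the reverse bound (`exists_slicing_succInradius_le`).

From cuts to planks (`AlexanderDavenportConjecture.bang`): planks of total `C`-width below 1 that
cover `C` are replaced by `M` hyperplanes, so closely spaced that every translate of `C/(M + 1)`
inside `C` is cut by one of them. -/

namespace PlankInradii

variable {d : ℕ}

/-! ### Directional and minimal widths of compact sets -/

/-- The width of a bounded set as a real number. -/
noncomputable def realWidth (K : Set (E d)) (u : E d) : ℝ :=
  sSup ((fun p : E d × E d => inner ℝ u p.1 - inner ℝ u p.2) '' (K ×ˢ K))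

theorem exists_realWidth_eq {K : Set (E d)} (hK : IsCompact K) (hne : K.Nonempty) (u : E d) :
    ∃ a ∈ K, ∃ b ∈ K, (∀ x ∈ K, inner ℝ u a ≤ inner ℝ u x ∧ inner ℝ u x ≤ inner ℝ u b) ∧
      realWidth K u = inner ℝ u b - inner ℝ u a := by
  have hc : ContinuousOn (fun x : E d => (inner ℝ u x : ℝ)) K := by fun_prop
  obtain ⟨a, ha, ha'⟩ := hK.exists_isMinOn hne hc
  obtain ⟨b, hb, hb'⟩ := hK.exists_isMaxOn hne hc
  refine ⟨a, ha, b, hb, fun x hx => ⟨ha' hx, hb' hx⟩, ?_⟩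
  refine IsGreatest.csSup_eq ⟨⟨(b, a), ⟨hb, ha⟩, rfl⟩, ?_⟩
  rintro _ ⟨⟨x, y⟩, ⟨hx, hy⟩, rfl⟩
  exact sub_le_sub (hb' hx) (ha' hy)

theorem inner_sub_inner_le_realWidth {K : Set (E d)} (hK : IsCompact K) (u : E d) {x y : E d}
    (hx : x ∈ K) (hy : y ∈ K) : inner ℝ u x - inner ℝ u y ≤ realWidth K u := by
  obtain ⟨a, -, b, -, h, e⟩ := exists_realWidth_eq hK ⟨x, hx⟩ u
  rw [e]
  exact sub_le_sub (h x hx).2 (h y hy).1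

theorem realWidth_nonneg {K : Set (E d)} (hK : IsCompact K) (hne : K.Nonempty) (u : E d) :
    0 ≤ realWidth K u := by
  obtain ⟨x, hx⟩ := hne
  simpa using inner_sub_inner_le_realWidth hK u hx hx

theorem realWidth_mono {K L : Set (E d)} (hK : IsCompact K) (hL : IsCompact L) (hne : K.Nonempty)
    (h : K ⊆ L) (u : E d) : realWidth K u ≤ realWidth L u := by
  obtain ⟨a, ha, b, hb, -, e⟩ := exists_realWidth_eq hK hne u
  rw [e]
  exact inner_sub_inner_le_realWidth hL u (h hb) (h ha)

theorem width_eq_ofReal {K : Set (E d)} (hK : IsCompact K) (hne : K.Nonempty) (u : E d) :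
    width K u = ENNReal.ofReal (realWidth K u) := by
  apply le_antisymm
  · refine iSup₂_le fun x hx => iSup₂_le fun y hy => ?_
    exact ENNReal.ofReal_le_ofReal (inner_sub_inner_le_realWidth hK u hx hy)
  · obtain ⟨a, ha, b, hb, -, e⟩ := exists_realWidth_eq hK hne u
    rw [e]
    exact le_iSup₂_of_le b hb (le_iSup₂_of_le a ha le_rfl)

theorem width_mono {K L : Set (E d)} (h : K ⊆ L) (u : E d) : width K u ≤ width L u :=
  iSup₂_le fun x hx => iSup₂_le fun y hy => le_iSup₂_of_le x (h hx) (le_iSup₂_of_le y (h hy) le_rfl)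

theorem continuous_realWidth {K : Set (E d)} (hK : IsCompact K) :
    Continuous (realWidth K) := by
  refine (hK.prod hK).continuous_sSup
    (f := fun (u : E d) (p : E d × E d) => inner ℝ u p.1 - inner ℝ u p.2) ?_
  simp only [Function.HasUncurry.uncurry, id]
  fun_prop

theorem realWidth_add {A B : Set (E d)} (hA : IsCompact A) (hB : IsCompact B)
    (hAne : A.Nonempty) (hBne : B.Nonempty) (u : E d) :
    realWidth (A + B) u = realWidth A u + realWidth B u := by
  obtain ⟨a, ha, b, hb, h, e⟩ := exists_realWidth_eq hA hAne u
  obtain ⟨a', ha', b', hb', h', e'⟩ := exists_realWidth_eq hB hBne u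
  refine IsGreatest.csSup_eq ⟨⟨(b + b', a + a'),
    ⟨Set.add_mem_add hb hb', Set.add_mem_add ha ha'⟩, ?_⟩, ?_⟩
  · simp only [inner_add_right, e, e']; ring
  · rintro _ ⟨⟨x, y⟩, ⟨⟨x1, hx1, x2, hx2, rfl⟩, ⟨y1, hy1, y2, hy2, rfl⟩⟩, rfl⟩
    simp only [inner_add_right, e, e']
    linarith [(h x1 hx1).2, (h' x2 hx2).2, (h y1 hy1).1, (h' y2 hy2).1]

theorem realWidth_smul {A : Set (E d)} (hA : IsCompact A) (hAne : A.Nonempty) {r : ℝ}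
    (hr : 0 ≤ r) (u : E d) : realWidth (r • A) u = r * realWidth A u := by
  obtain ⟨a, ha, b, hb, h, e⟩ := exists_realWidth_eq hA hAne u
  refine IsGreatest.csSup_eq ⟨⟨(r • b, r • a),
    ⟨Set.smul_mem_smul_set hb, Set.smul_mem_smul_set ha⟩, ?_⟩, ?_⟩
  · simp only [real_inner_smul_right, e]; ring
  · rintro _ ⟨⟨x, y⟩, ⟨⟨x, hx, rfl⟩, ⟨y, hy, rfl⟩⟩, rfl⟩
    simp only [real_inner_smul_right, e]
    nlinarith [mul_le_mul_of_nonneg_left (h x hx).2 hr, mul_le_mul_of_nonneg_left (h y hy).1 hr]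

namespace IsConvexBody

theorem nonempty {K : Set (E d)} (hK : IsConvexBody K) : K.Nonempty :=
  hK.interior_nonempty.mono interior_subset

theorem realWidth_pos {K : Set (E d)} (hK : IsConvexBody K) {u : E d} (hu : ‖u‖ = 1) :
    0 < realWidth K u := by
  obtain ⟨x, hx⟩ := hK.interior_nonempty
  obtain ⟨ε, hε, h⟩ := Metric.isOpen_iff.1 isOpen_interior x hx
  have hm : x + (ε / 2) • u ∈ K := by
    refine interior_subset (h ?_)
    rw [Metric.mem_ball, dist_eq_norm, add_sub_cancel_left, norm_smul, hu, mul_one,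
      Real.norm_of_nonneg (by positivity)]
    linarith
  have := inner_sub_inner_le_realWidth hK.isCompact u hm (interior_subset hx)
  rw [inner_add_right, real_inner_smul_right, real_inner_self_eq_norm_sq, hu] at this
  linarith

theorem width_ne_top {K : Set (E d)} (hK : IsConvexBody K) (u : E d) : width K u ≠ ∞ := by
  rw [width_eq_ofReal hK.isCompact hK.nonempty]
  exact ENNReal.ofReal_ne_top

theorem of_subset {K L : Set (E d)} (hL : IsConvexBody L) (hK : Convex ℝ K) (hKc : IsCompact K)
    (h : L ⊆ K) : IsConvexBody K :=
  ⟨hK, hKc, hL.interior_nonempty.mono (interior_mono h)⟩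

theorem vadd_smul {K : Set (E d)} (hK : IsConvexBody K) (t : E d) {r : ℝ} (hr : 0 < r) :
    IsConvexBody (t +ᵥ r • K) := by
  refine ⟨(hK.convex.smul r).vadd t, (hK.isCompact.smul r).vadd t, ?_⟩
  rw [interior_vadd, interior_smul₀ hr.ne']
  exact (hK.interior_nonempty.smul_set).vadd_set

end IsConvexBody

theorem relWidth_eq_ofReal {C K : Set (E d)} (hC : IsConvexBody C) (hK : IsCompact K)
    (hne : K.Nonempty) {u : E d} (hu : ‖u‖ = 1) :
    relWidth C K u = ENNReal.ofReal (realWidth K u / realWidth C u) := by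
  rw [relWidth, width_eq_ofReal hK hne, width_eq_ofReal hC.isCompact hC.nonempty,
    ENNReal.ofReal_div_of_pos (hC.realWidth_pos hu)]

theorem Plank.relWidth_eq_ofReal {C : Set (E d)} (hC : IsConvexBody C) (P : Plank d) :
    P.relWidth C = ENNReal.ofReal ((P.hi - P.lo) / realWidth C P.normal) := by
  rw [Plank.relWidth, width_eq_ofReal hC.isCompact hC.nonempty,
    ENNReal.ofReal_div_of_pos (hC.realWidth_pos P.norm_normal)]

/-- The minimal relative width of a compact set is attained. -/
theorem exists_minRelWidth_eq [Nontrivial (E d)] {C K : Set (E d)} (hC : IsConvexBody C)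
    (hK : IsCompact K) (hne : K.Nonempty) :
    ∃ u : E d, ‖u‖ = 1 ∧ minRelWidth C K = ENNReal.ofReal (realWidth K u / realWidth C u) ∧
      ∀ v : E d, ‖v‖ = 1 → realWidth K u / realWidth C u ≤ realWidth K v / realWidth C v := by
  have hs : (Metric.sphere (0 : E d) 1).Nonempty := NormedSpace.sphere_nonempty.2 zero_le_one
  obtain ⟨u, hu, h⟩ := (isCompact_sphere (0 : E d) 1).exists_isMinOn
    (f := fun u => realWidth K u / realWidth C u) hs
    ((continuous_realWidth hK).continuousOn.div (continuous_realWidth hC.isCompact).continuousOn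
      fun u hu => (hC.realWidth_pos (by simpa using hu)).ne')
  have hu' : ‖u‖ = 1 := by simpa using hu
  have h' : ∀ v : E d, ‖v‖ = 1 → realWidth K u / realWidth C u ≤ realWidth K v / realWidth C v :=
    fun v hv => h (by simpa using hv : v ∈ Metric.sphere (0 : E d) 1)
  refine ⟨u, hu', le_antisymm ?_ ?_, h'⟩
  · rw [← relWidth_eq_ofReal hC hK hne hu']
    exact iInf_le (fun v : Metric.sphere (0 : E d) 1 => relWidth C K v) ⟨u, hu⟩
  · refine le_iInf fun v => ?_
    have hv : ‖(v : E d)‖ = 1 := by simp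
    rw [relWidth_eq_ofReal hC hK hne hv]
    exact ENNReal.ofReal_le_ofReal (h' v hv)

/-- A compact convex set with positive width in all directions has interior points. -/
theorem isConvexBody_of_realWidth_pos {K : Set (E d)} (hc : Convex ℝ K) (hK : IsCompact K)
    (hne : K.Nonempty) (h : ∀ u : E d, ‖u‖ = 1 → 0 < realWidth K u) : IsConvexBody K := by
  refine ⟨hc, hK, ?_⟩
  rw [hc.interior_nonempty_iff_affineSpan_eq_top,
    ← AffineSubspace.direction_eq_top_iff_of_nonempty (hne.mono (subset_affineSpan ℝ K))]
  by_contra hD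
  set D := (affineSpan ℝ K).direction
  have hb : Dᗮ ≠ ⊥ := fun h => hD (by rwa [Submodule.orthogonal_eq_bot_iff] at h)
  -- If the affine span is proper, `K` has zero width along any normal to it.
  obtain ⟨w, hw, hw0⟩ := Submodule.exists_mem_ne_zero_of_ne_bot hb
  have hn : ‖w‖ ≠ 0 := norm_ne_zero_iff.2 hw0
  have hu : ‖(‖w‖⁻¹ • w)‖ = 1 := by rw [norm_smul, norm_inv, norm_norm, inv_mul_cancel₀ hn]
  obtain ⟨a, ha, b, hb, -, e⟩ := exists_realWidth_eq hK hne (‖w‖⁻¹ • w)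
  have hpos := h _ hu
  have hba : b - a ∈ D := AffineSubspace.vsub_mem_direction
    (subset_affineSpan ℝ K hb) (subset_affineSpan ℝ K ha)
  rw [e, ← inner_sub_right, real_inner_smul_left,
    Submodule.inner_left_of_mem_orthogonal hba hw, mul_zero] at hpos
  exact lt_irrefl _ hpos

/-- A convex body contains a small homothetic copy of any bounded set. -/
theorem IsConvexBody.exists_smul_subset {C K : Set (E d)} (hC : IsCompact C)
    (hK : IsConvexBody K) : ∃ t : E d, ∃ r : ℝ, 0 < r ∧ ∀ c ∈ C, t + r • c ∈ K := by
  obtain ⟨x, hx⟩ := hK.interior_nonempty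
  obtain ⟨ε, hε, h⟩ := Metric.isOpen_iff.1 isOpen_interior x hx
  obtain ⟨R, hR, hCR⟩ := hC.isBounded.exists_pos_norm_le
  refine ⟨x, ε / (2 * R), by positivity, fun c hc => interior_subset (h ?_)⟩
  rw [Metric.mem_ball, dist_eq_norm, add_sub_cancel_left, norm_smul,
    Real.norm_of_nonneg (by positivity)]
  calc ε / (2 * R) * ‖c‖ ≤ ε / (2 * R) * R := by gcongr; exact hCR c hc
    _ = ε / 2 := by field_simp
    _ < ε := by linarith

/-! ### Centers and rounded bodies -/

/-- The translation vectors that carry `ρ • C` into `K`. -/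
def centers (C K : Set (E d)) (ρ : ℝ) : Set (E d) :=
  {t | ∀ c ∈ C, t + ρ • c ∈ K}

theorem vadd_smul_subset_iff {C K : Set (E d)} {ρ : ℝ} {t : E d} :
    t +ᵥ ρ • C ⊆ K ↔ t ∈ centers C K ρ := by
  constructor
  · intro h c hc
    exact h (Set.vadd_mem_vadd_set (Set.smul_mem_smul_set hc))
  · rintro h _ ⟨_, ⟨c, hc, rfl⟩, rfl⟩
    exact h c hc

theorem mem_roundedBody {C K : Set (E d)} {ρ : ℝ} {x : E d} :
    x ∈ roundedBody C K ρ ↔ ∃ t ∈ centers C K ρ, ∃ c ∈ C, t + ρ • c = x := by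
  simp only [roundedBody, Set.mem_iUnion₂, Set.mem_ofPred_eq, vadd_smul_subset_iff, exists_prop]
  refine exists_congr fun t => and_congr_right fun _ => ⟨?_, ?_⟩
  · rintro ⟨_, ⟨c, hc, rfl⟩, rfl⟩
    exact ⟨c, hc, rfl⟩
  · rintro ⟨c, hc, rfl⟩
    exact Set.vadd_mem_vadd_set (Set.smul_mem_smul_set hc)

theorem roundedBody_eq_add (C K : Set (E d)) (ρ : ℝ) :
    roundedBody C K ρ = centers C K ρ + ρ • C := by
  ext x
  rw [mem_roundedBody, Set.mem_add]
  refine exists_congr fun t => and_congr_right fun _ => ⟨?_, ?_⟩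
  · rintro ⟨c, hc, rfl⟩
    exact ⟨_, Set.smul_mem_smul_set hc, rfl⟩
  · rintro ⟨_, ⟨c, hc, rfl⟩, rfl⟩
    exact ⟨c, hc, rfl⟩

theorem roundedBody_subset (C K : Set (E d)) (ρ : ℝ) : roundedBody C K ρ ⊆ K := by
  intro x hx
  obtain ⟨t, ht, c, hc, rfl⟩ := mem_roundedBody.1 hx
  exact ht c hc

theorem roundedBody_mono (C : Set (E d)) {K L : Set (E d)} (h : K ⊆ L) (ρ : ℝ) :
    roundedBody C K ρ ⊆ roundedBody C L ρ := by
  intro x hx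
  obtain ⟨t, ht, c, hc, rfl⟩ := mem_roundedBody.1 hx
  exact mem_roundedBody.2 ⟨t, fun c hc => h (ht c hc), c, hc, rfl⟩

theorem inradius_eq (C K : Set (E d)) :
    inradius C K = sSup {ρ : ℝ | 0 < ρ ∧ (centers C K ρ).Nonempty} := by
  simp only [inradius, vadd_smul_subset_iff]
  rfl

/-- Enlarging a homothetic copy: the smaller copies sweep out the larger one. -/
theorem add_smul_mem_centers {C K : Set (E d)} (hC : Convex ℝ C) {s σ : ℝ} (hs : 0 ≤ s)
    (h : s ≤ σ) {t : E d} (ht : t ∈ centers C K σ) {c : E d} (hc : c ∈ C) :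
    t + (σ - s) • c ∈ centers C K s := by
  intro c' hc'
  have hm : (σ - s) • c + s • c' ∈ (σ - s + s) • C := by
    rw [hC.add_smul (sub_nonneg.2 h) hs]
    exact Set.add_mem_add (Set.smul_mem_smul_set hc) (Set.smul_mem_smul_set hc')
  rw [sub_add_cancel] at hm
  obtain ⟨c'', hc'', e⟩ := hm
  have := ht c'' hc''
  simp only at e
  rwa [e, ← add_assoc] at this

theorem roundedBody_anti {C : Set (E d)} (hC : Convex ℝ C) (K : Set (E d)) {s σ : ℝ}
    (hs : 0 ≤ s) (h : s ≤ σ) : roundedBody C K σ ⊆ roundedBody C K s := by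
  intro x hx
  obtain ⟨t, ht, c, hc, rfl⟩ := mem_roundedBody.1 hx
  refine mem_roundedBody.2 ⟨_, add_smul_mem_centers hC hs h ht hc, c, hc, ?_⟩
  rw [add_assoc, ← add_smul, sub_add_cancel]

theorem add_mem_centers_of_convex {C K : Set (E d)} (hK : Convex ℝ K) {ρ σ : ℝ} {t t' : E d}
    (ht : t ∈ centers C K ρ) (ht' : t' ∈ centers C K σ) {a b : ℝ} (ha : 0 ≤ a) (hb : 0 ≤ b)
    (hab : a + b = 1) : a • t + b • t' ∈ centers C K (a * ρ + b * σ) := by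
  intro c hc
  have := hK (ht c hc) (ht' c hc) ha hb hab
  convert this using 1
  module

theorem convex_centers (C : Set (E d)) {K : Set (E d)} (hK : Convex ℝ K) (ρ : ℝ) :
    Convex ℝ (centers C K ρ) := by
  intro t ht t' ht' a b ha hb hab
  have := add_mem_centers_of_convex hK ht ht' ha hb hab
  rwa [← add_mul, hab, one_mul] at this

/-- Closedness jointly in the factor and the translation is what makes the set of admissible factors
compact. -/
theorem isClosed_centers_graph (C : Set (E d)) {K : Set (E d)} (hK : IsClosed K) :
    IsClosed {p : ℝ × E d | p.2 ∈ centers C K p.1} := by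
  have : {p : ℝ × E d | p.2 ∈ centers C K p.1} =
      ⋂ c ∈ C, (fun p : ℝ × E d => p.2 + p.1 • c) ⁻¹' K := by
    ext p; simp [centers]
  rw [this]
  exact isClosed_biInter fun c _ => hK.preimage (by fun_prop)

theorem isCompact_centers {C K : Set (E d)} (hC : C.Nonempty) (hK : IsCompact K) (ρ : ℝ) :
    IsCompact (centers C K ρ) := by
  obtain ⟨c, hc⟩ := hC
  refine (hK.image (continuous_sub_right (ρ • c))).of_isClosed_subset
    ((isClosed_centers_graph C hK.isClosed).preimage
      (by fun_prop : Continuous fun t : E d => (ρ, t))) fun t ht => ⟨_, ht c hc, by simp⟩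

theorem isCompact_roundedBody {C K : Set (E d)} (hC : IsConvexBody C) (hK : IsCompact K) (ρ : ℝ) :
    IsCompact (roundedBody C K ρ) := by
  rw [roundedBody_eq_add]
  exact (isCompact_centers hC.nonempty hK ρ).add (hC.isCompact.smul ρ)

theorem roundedBody_nonempty {C K : Set (E d)} (hC : IsConvexBody C) {ρ : ℝ}
    (h : (centers C K ρ).Nonempty) : (roundedBody C K ρ).Nonempty := by
  rw [roundedBody_eq_add]
  exact h.add hC.nonempty.smul_set

theorem realWidth_roundedBody {C K : Set (E d)} (hC : IsConvexBody C) (hK : IsCompact K) {ρ : ℝ}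
    (hρ : 0 ≤ ρ) (h : (centers C K ρ).Nonempty) (u : E d) :
    realWidth (roundedBody C K ρ) u = realWidth (centers C K ρ) u + ρ * realWidth C u := by
  rw [roundedBody_eq_add, realWidth_add (isCompact_centers hC.nonempty hK ρ) (hC.isCompact.smul ρ) h
    hC.nonempty.smul_set, realWidth_smul hC.isCompact hC.nonempty hρ]

theorem isConvexBody_roundedBody {C K : Set (E d)} (hC : IsConvexBody C) (hK : IsConvexBody K)
    {ρ : ℝ} (hρ : 0 < ρ) (h : (centers C K ρ).Nonempty) : IsConvexBody (roundedBody C K ρ) := by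
  obtain ⟨t, ht⟩ := h
  refine (hC.vadd_smul t hρ).of_subset ?_ (isCompact_roundedBody hC hK.isCompact ρ) ?_
  · rw [roundedBody_eq_add]
    exact (convex_centers C hK.convex ρ).add (hC.convex.smul ρ)
  · rintro _ ⟨_, ⟨c, hc, rfl⟩, rfl⟩
    exact mem_roundedBody.2 ⟨t, ht, c, hc, rfl⟩

theorem bddAbove_centers_nonempty [Nontrivial (E d)] {C K : Set (E d)} (hC : IsConvexBody C)
    (hK : IsConvexBody K) : ∃ R : ℝ, ∀ ρ, 0 ≤ ρ → (centers C K ρ).Nonempty → ρ ≤ R := by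
  obtain ⟨u, hu⟩ := exists_norm_eq (E d) (zero_le_one (α := ℝ))
  refine ⟨realWidth K u / realWidth C u, fun ρ hρ h => ?_⟩
  rw [le_div_iff₀ (hC.realWidth_pos hu)]
  have h1 := realWidth_mono (isCompact_roundedBody hC hK.isCompact ρ) hK.isCompact
    (roundedBody_nonempty hC h) (roundedBody_subset C K ρ) u
  rw [realWidth_roundedBody hC hK.isCompact hρ h] at h1
  linarith [realWidth_nonneg (isCompact_centers hC.nonempty hK.isCompact ρ) h u]

/-! ### Successive inradii as greatest wide factors -/

/-- The factors `ρ` for which the set of centers is at least as wide as `k ρ C`. -/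
def wideFactors (C K : Set (E d)) (k : ℝ) : Set ℝ :=
  {ρ | 0 ≤ ρ ∧ (centers C K ρ).Nonempty ∧
    ∀ u : E d, ‖u‖ = 1 → k * ρ * realWidth C u ≤ realWidth (centers C K ρ) u}

theorem exists_isGreatest_wideFactors [Nontrivial (E d)] {C K : Set (E d)} (hC : IsConvexBody C)
    (hK : IsConvexBody K) (k : ℝ) : ∃ s, IsGreatest (wideFactors C K k) s := by
  obtain ⟨R, hR⟩ := bddAbove_centers_nonempty hC hK
  obtain ⟨c, hc⟩ := hC.nonempty
  -- For a fixed direction the width condition is witnessed by two centers. The triples of a factor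
  -- and two witnesses form a compact set, and the wide factors are the intersection over all
  -- directions of its projections.
  let F : E d → Set (ℝ × E d × E d) := fun u => {p | p.1 ∈ Set.Icc 0 R ∧
    p.2.1 ∈ centers C K p.1 ∧ p.2.2 ∈ centers C K p.1 ∧
    k * p.1 * realWidth C u ≤ inner ℝ u p.2.1 - inner ℝ u p.2.2}
  have hF : ∀ u, IsCompact (F u) := by
    intro u
    have hG := isClosed_centers_graph C hK.isCompact.isClosed
    have hl : IsClosed {p : ℝ × E d × E d |
        k * p.1 * realWidth C u ≤ inner ℝ u p.2.1 - inner ℝ u p.2.2} :=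
      isClosed_le (by fun_prop) (by fun_prop)
    have hcl : IsClosed (F u) := by
      exact (isClosed_Icc.preimage continuous_fst).inter
        ((hG.preimage (f := fun p : ℝ × E d × E d => (p.1, p.2.1)) (by fun_prop)).inter
        ((hG.preimage (f := fun p : ℝ × E d × E d => (p.1, p.2.2)) (by fun_prop)).inter hl))
    let g : ℝ × E d × E d → ℝ × E d × E d := fun p => (p.1, p.2.1 - p.1 • c, p.2.2 - p.1 • c)
    have hg : Continuous g := by fun_prop
    refine (((isCompact_Icc (a := (0 : ℝ)) (b := R)).prod
      (hK.isCompact.prod hK.isCompact)).image hg).of_isClosed_subset hcl ?_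
    rintro ⟨ρ, t, t'⟩ ⟨h1, h2, h3, -⟩
    exact ⟨(ρ, t + ρ • c, t' + ρ • c), ⟨h1, h2 c hc, h3 c hc⟩, by simp [g]⟩
  have hS : wideFactors C K k = ⋂ u ∈ {u : E d | ‖u‖ = 1}, Prod.fst '' F u := by
    ext ρ
    simp only [Set.mem_iInter₂, Set.mem_ofPred_eq]
    constructor
    · rintro ⟨h0, hne, h⟩ u hu
      obtain ⟨a, ha, b, hb, -, e⟩ :=
        exists_realWidth_eq (isCompact_centers hC.nonempty hK.isCompact ρ) hne u
      exact ⟨(ρ, b, a), ⟨⟨h0, hR ρ h0 hne⟩, hb, ha, e ▸ h u hu⟩, rfl⟩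
    · intro h
      obtain ⟨u, hu⟩ := exists_norm_eq (E d) (zero_le_one (α := ℝ))
      obtain ⟨⟨_, t, t'⟩, ⟨h1, h2, -, -⟩, rfl⟩ := h u hu
      refine ⟨h1.1, ⟨t, h2⟩, fun v hv => ?_⟩
      obtain ⟨⟨ρ', b, a⟩, ⟨-, hb, ha, hl⟩, e⟩ := h v hv
      simp only at e hb ha hl ⊢
      subst e
      exact hl.trans
        (inner_sub_inner_le_realWidth (isCompact_centers hC.nonempty hK.isCompact _) v hb ha)
  obtain ⟨u, hu⟩ := exists_norm_eq (E d) (zero_le_one (α := ℝ))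
  have hcomp : IsCompact (wideFactors C K k) := by
    refine ((hF u).image continuous_fst).of_isClosed_subset ?_ ?_
    · rw [hS]
      exact isClosed_biInter fun v _ => ((hF v).image continuous_fst).isClosed
    · rw [hS]
      exact Set.biInter_subset_of_mem hu
  refine hcomp.exists_isGreatest ⟨0, le_rfl, ?_, fun v _ => ?_⟩
  · obtain ⟨x, hx⟩ := hK.nonempty
    exact ⟨x, fun c _ => by simpa using hx⟩
  · simp only [mul_zero, zero_mul]
    obtain ⟨x, hx⟩ := hK.nonempty
    exact realWidth_nonneg (isCompact_centers hC.nonempty hK.isCompact _)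
      ⟨x, fun c _ => by simpa using hx⟩ v

/-- Slack in the width condition leaves room to increase the factor. The centers then form a convex
body, which contains some `t + δC`, so `t` is a center for `s + δ`. Contracting the centers slightly
towards `t` gives centers for a larger factor, at a small cost in width. -/
theorem exists_wideFactors_gt {C K : Set (E d)} (hC : IsConvexBody C)
    (hK : IsConvexBody K) {k s c : ℝ} (hk : 0 ≤ k) (hs : 0 ≤ s) (hne : (centers C K s).Nonempty)
    (hc : k * s < c)
    (h : ∀ u : E d, ‖u‖ = 1 → c * realWidth C u ≤ realWidth (centers C K s) u) :
    ∃ ρ ∈ wideFactors C K k, s < ρ := by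
  have hcomp := isCompact_centers hC.nonempty hK.isCompact s
  have hc0 : 0 < c := lt_of_le_of_lt (by positivity) hc
  have hD : IsConvexBody (centers C K s) :=
    isConvexBody_of_realWidth_pos (convex_centers C hK.convex s) hcomp hne fun u hu =>
      (mul_pos hc0 (hC.realWidth_pos hu)).trans_le (h u hu)
  obtain ⟨t, δ, hδ, ht⟩ := hD.exists_smul_subset hC.isCompact
  have ht' : t ∈ centers C K (s + δ) := by
    intro x hx
    have := ht x hx x hx
    convert this using 1
    module
  -- With `y = c - k s`, the requirement is `l (k δ + c) ≤ y`; the additional `y` in the denominator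
  -- keeps `l < 1` even for `k = 0`.
  obtain ⟨l, hl0, hl1, hl⟩ : ∃ l : ℝ, 0 < l ∧ l < 1 ∧ k * (s + l * δ) ≤ (1 - l) * c := by
    refine ⟨(c - k * s) / (c - k * s + k * δ + c), div_pos (sub_pos.2 hc) ?_, ?_, ?_⟩
    · nlinarith [mul_nonneg hk hδ.le]
    · rw [div_lt_one (by nlinarith [mul_nonneg hk hδ.le])]
      nlinarith [mul_nonneg hk hδ.le]
    · set y := c - k * s with hy
      have hy0 : 0 < y := sub_pos.2 hc
      set l := y / (y + k * δ + c) with hl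
      have hden : 0 < y + k * δ + c := by nlinarith [mul_nonneg hk hδ.le]
      have e : l * (y + k * δ + c) = y := div_mul_cancel₀ _ hden.ne'
      have : 0 < l := div_pos hy0 hden
      nlinarith [mul_pos this hy0]
  have hmem : ∀ x ∈ centers C K s, (1 - l) • x + l • t ∈ centers C K (s + l * δ) := by
    intro x hx
    have := add_mem_centers_of_convex hK.convex hx ht' (sub_nonneg.2 hl1.le) hl0.le (by ring)
    convert this using 2
    ring
  refine ⟨s + l * δ, ⟨by positivity, hne.imp' _ hmem, fun u hu => ?_⟩, by
    linarith [mul_pos hl0 hδ]⟩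
  obtain ⟨a, ha, b, hb, -, e⟩ := exists_realWidth_eq hcomp hne u
  have h1 := inner_sub_inner_le_realWidth (isCompact_centers hC.nonempty hK.isCompact _) u
    (hmem b hb) (hmem a ha)
  simp only [inner_add_right, real_inner_smul_right] at h1
  have h2 := h u hu
  have h3 := mul_le_mul_of_nonneg_right hl (hC.realWidth_pos hu).le
  have h4 := mul_le_mul_of_nonneg_left h2 (sub_nonneg.2 hl1.le)
  rw [e] at h4
  linarith

theorem pos_of_isGreatest_wideFactors {C K : Set (E d)} (hC : IsConvexBody C)
    (hK : IsConvexBody K) {k s : ℝ} (hk : 0 ≤ k) (h : IsGreatest (wideFactors C K k) s) :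
    0 < s := by
  refine h.1.1.lt_of_ne fun h0 => ?_
  subst h0
  obtain ⟨t, r, hr, ht⟩ := hK.exists_smul_subset hC.isCompact
  -- At factor zero the centers are all of `K`, which has positive width, so there is slack and zero
  -- is not maximal.
  have he : K = centers C K 0 := by
    ext x
    refine ⟨fun hx c _ => by simpa using hx, fun hx => ?_⟩
    obtain ⟨c, hc⟩ := hC.nonempty
    simpa using hx c hc
  have hsub : t +ᵥ r • C ⊆ K := vadd_smul_subset_iff.2 ht
  obtain ⟨ρ, hρ, h'⟩ := exists_wideFactors_gt (k := k) (s := 0) (c := r) hC hK hk le_rfl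
    (he ▸ hK.nonempty) (by simpa using hr) (fun u _ => by
      obtain ⟨a, ha, b, hb, -, e⟩ := exists_realWidth_eq hC.isCompact hC.nonempty u
      rw [← he, e]
      have := inner_sub_inner_le_realWidth hK.isCompact u (ht b hb) (ht a ha)
      simp only [inner_add_right, real_inner_smul_right] at this
      linarith)
  exact (h.2 hρ).not_gt h'

/-- The greatest wide factor satisfies the defining equation of the successive inradius. -/
theorem exists_realWidth_eq_of_isGreatest_wideFactors [Nontrivial (E d)] {C K : Set (E d)}
    (hC : IsConvexBody C) (hK : IsConvexBody K) {k s : ℝ} (hk : 0 ≤ k)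
    (h : IsGreatest (wideFactors C K k) s) :
    ∃ u : E d, ‖u‖ = 1 ∧ realWidth (centers C K s) u = k * s * realWidth C u := by
  obtain ⟨⟨hs, hne, hw⟩, hmax⟩ := h
  obtain ⟨u, hu, -, hmin⟩ := exists_minRelWidth_eq hC
    (isCompact_centers hC.nonempty hK.isCompact s) hne
  refine ⟨u, hu, le_antisymm ?_ (hw u hu)⟩
  by_contra! hlt
  obtain ⟨ρ, hρ, h'⟩ := exists_wideFactors_gt hC hK hk hs hne
    ((lt_div_iff₀ (hC.realWidth_pos hu)).2 hlt) fun v hv =>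
      (le_div_iff₀ (hC.realWidth_pos hv)).1 (hmin v hv)
  exact (hmax hρ).not_gt h'

theorem minRelWidth_empty [Nontrivial (E d)] (C : Set (E d)) : minRelWidth C ∅ = 0 := by
  obtain ⟨u, hu⟩ := exists_norm_eq (E d) (zero_le_one (α := ℝ))
  refine le_antisymm ((iInf_le _ ⟨u, by simpa using hu⟩).trans ?_) bot_le
  simp [relWidth, width]

theorem le_inradius [Nontrivial (E d)] {C K : Set (E d)} (hC : IsConvexBody C)
    (hK : IsConvexBody K) {ρ : ℝ} (hρ : 0 < ρ) (h : (centers C K ρ).Nonempty) :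
    ρ ≤ inradius C K := by
  rw [inradius_eq]
  obtain ⟨R, hR⟩ := bddAbove_centers_nonempty hC hK
  exact le_csSup ⟨R, fun σ hσ => hR σ hσ.1.le hσ.2⟩ ⟨hρ, h⟩

theorem minRelWidth_roundedBody_of_isGreatest_wideFactors [Nontrivial (E d)] {C K : Set (E d)}
    (hC : IsConvexBody C) (hK : IsConvexBody K) {k s : ℝ} (hk : 0 ≤ k)
    (h : IsGreatest (wideFactors C K k) s) :
    minRelWidth C (roundedBody C K s) = ENNReal.ofReal ((k + 1) * s) := by
  obtain ⟨v, hv, ev⟩ := exists_realWidth_eq_of_isGreatest_wideFactors hC hK hk h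
  obtain ⟨⟨hs, hne, hw⟩, -⟩ := h
  have hwr := realWidth_roundedBody hC hK.isCompact hs hne
  obtain ⟨u, hu, e, hmin⟩ := exists_minRelWidth_eq hC
    (isCompact_roundedBody hC hK.isCompact s) (roundedBody_nonempty hC hne)
  rw [e]
  congr 1
  apply le_antisymm
  · refine (hmin v hv).trans ?_
    rw [div_le_iff₀ (hC.realWidth_pos hv), hwr, ev]
    linarith
  · rw [le_div_iff₀ (hC.realWidth_pos hu), hwr]
    linarith [hw u hu]

/-- The successive inradius of a convex body is the greatest wide factor. -/
theorem isGreatest_succInradius [Nontrivial (E d)] {C K : Set (E d)} (hC : IsConvexBody C)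
    (hK : IsConvexBody K) {m : ℕ} (hm : 1 ≤ m) :
    IsGreatest (wideFactors C K (m - 1)) (succInradius C K m) := by
  have hm' : (1 : ℝ) ≤ m := by exact_mod_cast hm
  obtain ⟨s, hs⟩ := exists_isGreatest_wideFactors hC hK (m - 1)
  have hs0 := pos_of_isGreatest_wideFactors hC hK (sub_nonneg.2 hm') hs
  have hmin := minRelWidth_roundedBody_of_isGreatest_wideFactors hC hK (sub_nonneg.2 hm') hs
  rw [sub_add_cancel] at hmin
  suffices h : {ρ : ℝ | 0 < ρ ∧ ρ ≤ inradius C K ∧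
      minRelWidth C (roundedBody C K ρ) = ENNReal.ofReal ((m : ℝ) * ρ)} = {s} by
    rw [succInradius, h, csSup_singleton]
    exact hs
  ext ρ
  simp only [Set.mem_ofPred_eq, Set.mem_singleton_iff]
  constructor
  · rintro ⟨hρ, -, e⟩
    have hmρ : 0 < m * ρ := by positivity
    -- Without centers the rounded body is empty and has minimal width zero, not `m ρ`.
    have hne : (centers C K ρ).Nonempty := by
      by_contra h0
      rw [roundedBody_eq_add, Set.not_nonempty_iff_eq_empty.1 h0, Set.empty_add,
        minRelWidth_empty, eq_comm, ENNReal.ofReal_eq_zero] at e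
      linarith
    have hle : ρ ≤ s := by
      refine hs.2 ⟨hρ.le, hne, fun v hv => ?_⟩
      obtain ⟨u, hu, e', h'⟩ := exists_minRelWidth_eq hC
        (isCompact_roundedBody hC hK.isCompact ρ) (roundedBody_nonempty hC hne)
      have hnn : 0 ≤ realWidth (roundedBody C K ρ) u / realWidth C u :=
        div_nonneg (realWidth_nonneg (isCompact_roundedBody hC hK.isCompact ρ)
          (roundedBody_nonempty hC hne) u) (hC.realWidth_pos hu).le
      rw [e', ENNReal.ofReal_eq_ofReal_iff hnn hmρ.le] at e
      have := h' v hv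
      rw [e, le_div_iff₀ (hC.realWidth_pos hv),
        realWidth_roundedBody hC hK.isCompact hρ.le hne] at this
      linarith
    refine le_antisymm hle ?_
    -- Rounded bodies decrease in the factor, so `m s ≤ m ρ`; this forces uniqueness.
    have hmono : minRelWidth C (roundedBody C K s) ≤ minRelWidth C (roundedBody C K ρ) :=
      iInf_mono fun u => ENNReal.div_le_div_right
        (width_mono (roundedBody_anti hC.convex K hρ.le hle) u) _
    rw [hmin, e, ENNReal.ofReal_le_ofReal_iff hmρ.le] at hmono
    exact le_of_mul_le_mul_left hmono (by positivity)
  · rintro rfl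
    exact ⟨hs0, le_inradius hC hK hs0 hs.1.2.1, hmin⟩

theorem succInradius_pos [Nontrivial (E d)] {C K : Set (E d)} (hC : IsConvexBody C)
    (hK : IsConvexBody K) {m : ℕ} (hm : 1 ≤ m) : 0 < succInradius C K m :=
  pos_of_isGreatest_wideFactors hC hK (sub_nonneg.2 (by exact_mod_cast hm))
    (isGreatest_succInradius hC hK hm)

theorem centers_succInradius_nonempty [Nontrivial (E d)] {C K : Set (E d)} (hC : IsConvexBody C)
    (hK : IsConvexBody K) {m : ℕ} (hm : 1 ≤ m) : (centers C K (succInradius C K m)).Nonempty :=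
  (isGreatest_succInradius hC hK hm).1.2.1

theorem minRelWidth_roundedBody_succInradius [Nontrivial (E d)] {C K : Set (E d)} (hC : IsConvexBody C)
    (hK : IsConvexBody K) {m : ℕ} (hm : 1 ≤ m) :
    minRelWidth C (roundedBody C K (succInradius C K m)) =
      ENNReal.ofReal (m * succInradius C K m) := by
  have := minRelWidth_roundedBody_of_isGreatest_wideFactors hC hK
    (sub_nonneg.2 (by exact_mod_cast hm)) (isGreatest_succInradius hC hK hm)
  rwa [sub_add_cancel] at this

theorem succInradius_one [Nontrivial (E d)] {C K : Set (E d)} (hC : IsConvexBody C)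
    (hK : IsConvexBody K) : succInradius C K 1 = inradius C K := by
  have h := isGreatest_succInradius hC hK le_rfl
  have hs := succInradius_pos hC hK le_rfl
  rw [inradius_eq]
  have hg : IsGreatest {ρ : ℝ | 0 < ρ ∧ (centers C K ρ).Nonempty} (succInradius C K 1) := by
    refine ⟨⟨hs, h.1.2.1⟩, ?_⟩
    rintro σ ⟨hσ, hne⟩
    refine h.2 ⟨hσ.le, hne, fun u _ => ?_⟩
    simpa using realWidth_nonneg (isCompact_centers hC.nonempty hK.isCompact σ) hne u
  exact hg.csSup_eq.symm

/-- The `m`-th successive inradius of `C` relative to itself is at least `1 / m`. -/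
theorem one_div_le_succInradius_self [Nontrivial (E d)] {C : Set (E d)} (hC : IsConvexBody C)
    {m : ℕ} (hm : 1 ≤ m) : 1 / (m : ℝ) ≤ succInradius C C m := by
  have hm' : (1 : ℝ) ≤ m := by exact_mod_cast hm
  have hm0 : (0 : ℝ) < m := by linarith
  have h1 : (0 : ℝ) ≤ 1 - 1 / m := sub_nonneg.2 ((div_le_one hm0).2 hm')
  -- By convexity these points are centers for the factor `1 / m`, and their `C`-width is `1 - 1/m =
  -- (m - 1)/m`, just what is needed.
  have hsub : ((1 : ℝ) - 1 / m) • C ⊆ centers C C (1 / m) := by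
    rintro _ ⟨x, hx, rfl⟩ c hc
    exact hC.convex hx hc h1 (by positivity) (by ring)
  refine (isGreatest_succInradius hC hC hm).2
    ⟨by positivity, hC.nonempty.smul_set.mono hsub, fun u _ => ?_⟩
  have := realWidth_mono (hC.isCompact.smul _) (isCompact_centers hC.nonempty hC.isCompact (1 / m))
    hC.nonempty.smul_set hsub u
  rw [realWidth_smul hC.isCompact hC.nonempty h1] at this
  convert this using 2
  field_simp

/-! ### Widths and successive inradii of planks -/

theorem inner_smul_normal {u : E d} (hu : ‖u‖ = 1) (a : ℝ) : inner ℝ u (a • u) = a := by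
  rw [real_inner_smul_right, real_inner_self_eq_norm_sq, hu]; ring

namespace Plank

theorem width_carrier_normal (P : Plank d) :
    width P.carrier P.normal = ENNReal.ofReal (P.hi - P.lo) := by
  have h := P.lo_lt_hi.le
  apply le_antisymm
  · refine iSup₂_le fun x hx => iSup₂_le fun y hy => ENNReal.ofReal_le_ofReal ?_
    exact sub_le_sub hx.2 hy.1
  · have hm : ∀ a : ℝ, P.lo ≤ a → a ≤ P.hi → a • P.normal ∈ P.carrier := by
      intro a h1 h2
      simp only [carrier, Set.mem_ofPred_eq, inner_smul_normal P.norm_normal]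
      exact ⟨h1, h2⟩
    refine le_iSup₂_of_le _ (hm _ h le_rfl) (le_iSup₂_of_le _ (hm _ le_rfl h) ?_)
    rw [inner_smul_normal P.norm_normal, inner_smul_normal P.norm_normal]

theorem width_carrier_neg (P : Plank d) (v : E d) : width P.carrier (-v) = width P.carrier v := by
  have key : ∀ v : E d, width P.carrier (-v) ≤ width P.carrier v := by
    intro v
    refine iSup₂_le fun x hx => iSup₂_le fun y hy => ?_
    refine le_iSup₂_of_le y hy (le_iSup₂_of_le x hx (ENNReal.ofReal_le_ofReal ?_))
    simp only [inner_neg_left]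
    linarith
  refine le_antisymm (key v) ?_
  simpa using key (-v)

/-- A plank is unbounded in every direction not parallel to its normal. -/
theorem width_carrier_eq_top (P : Plank d) {v : E d} (hv : ‖v‖ = 1) (h1 : v ≠ P.normal)
    (h2 : v ≠ -P.normal) : width P.carrier v = ∞ := by
  set u := P.normal with hu
  have hu1 : ‖u‖ = 1 := P.norm_normal
  set z : E d := v - (inner ℝ u v : ℝ) • u with hz
  have huz : inner ℝ u z = 0 := by
    rw [hz, inner_sub_right, inner_smul_normal hu1, sub_self]
  have hvz : inner ℝ v z = ‖z‖ ^ 2 := by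
    have : v = z + (inner ℝ u v : ℝ) • u := by rw [hz]; abel
    conv_lhs => rw [this]
    rw [inner_add_left, real_inner_smul_left, huz, mul_zero, add_zero, real_inner_self_eq_norm_sq]
  have hz0 : z ≠ 0 := by
    intro h0
    have hv' : v = (inner ℝ u v : ℝ) • u := sub_eq_zero.1 h0
    have hn : |(inner ℝ u v : ℝ)| = 1 := by
      have := congrArg norm hv'
      rwa [norm_smul, hu1, mul_one, hv, Real.norm_eq_abs, eq_comm] at this
    rcases eq_or_eq_neg_of_abs_eq hn with h | h
    · exact h1 (by rw [hv', h, one_smul])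
    · exact h2 (by rw [hv', h, neg_one_smul])
  have hzp : 0 < ‖z‖ ^ 2 := by positivity
  have hm : ∀ a : ℝ, P.lo • u + a • z ∈ P.carrier := by
    intro a
    simp only [carrier, Set.mem_ofPred_eq, ← hu, inner_add_right, inner_smul_normal hu1,
      real_inner_smul_right, huz]
    exact ⟨by simp, by simpa using P.lo_lt_hi.le⟩
  refine ENNReal.eq_top_of_forall_nnreal_le fun r => ?_
  refine le_iSup₂_of_le _ (hm ((r : ℝ) / ‖z‖ ^ 2)) (le_iSup₂_of_le _ (hm 0) ?_)
  rw [inner_add_right, inner_add_right, real_inner_smul_right _ z, real_inner_smul_right _ z, hvz,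
    div_mul_cancel₀ _ hzp.ne']
  simp

theorem minRelWidth_carrier {C : Set (E d)} (hC : IsConvexBody C) (P : Plank d) :
    minRelWidth C P.carrier = P.relWidth C := by
  apply le_antisymm
  · refine (iInf_le _ ⟨P.normal, by simpa using P.norm_normal⟩).trans ?_
    simp only [PlankInradii.relWidth, width_carrier_normal]
    rfl
  · refine le_iInf fun v => ?_
    have hv : ‖(v : E d)‖ = 1 := by simp
    rw [PlankInradii.relWidth]
    by_cases h1 : (v : E d) = P.normal
    · rw [h1, width_carrier_normal]
      rfl
    by_cases h2 : (v : E d) = -P.normal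
    · have hw : width C (-P.normal) = width C P.normal := by
        rw [width_eq_ofReal hC.isCompact hC.nonempty, width_eq_ofReal hC.isCompact hC.nonempty]
        obtain ⟨a, ha, b, hb, h, e⟩ := exists_realWidth_eq hC.isCompact hC.nonempty P.normal
        obtain ⟨a', ha', b', hb', h', e'⟩ :=
          exists_realWidth_eq hC.isCompact hC.nonempty (-P.normal)
        simp only [inner_neg_left] at h' e'
        congr 1
        rw [e, e']
        linarith [h a' ha', h b' hb', h' a ha, h' b hb]
      rw [h2, width_carrier_neg, width_carrier_normal, hw]
      rfl
    · rw [width_carrier_eq_top P hv h1 h2, ENNReal.top_div_of_ne_top (hC.width_ne_top _)]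
      exact le_top

/-- Every point of the plank lies in a translate of `ρC` inside it: the point `c` of `C` is chosen
at the same relative height `θ` between the supporting hyperplanes of `C` as `x` has in the plank.
-/
theorem exists_mem_centers {C : Set (E d)} (hC : IsConvexBody C) (P : Plank d) {ρ : ℝ}
    (hρ0 : 0 ≤ ρ) (hρ : ρ ≤ (P.hi - P.lo) / realWidth C P.normal) {x : E d} (hx : x ∈ P.carrier) :
    ∃ c ∈ C, x - ρ • c ∈ centers C P.carrier ρ := by
  obtain ⟨a, ha, b, hb, h, e⟩ := exists_realWidth_eq hC.isCompact hC.nonempty P.normal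
  rw [le_div_iff₀ (hC.realWidth_pos P.norm_normal), e] at hρ
  have hD : 0 < P.hi - P.lo := sub_pos.2 P.lo_lt_hi
  set θ := (inner ℝ P.normal x - P.lo) / (P.hi - P.lo) with hθ
  have hθ0 : 0 ≤ θ := div_nonneg (sub_nonneg.2 hx.1) hD.le
  have hθ1 : θ ≤ 1 := (div_le_one hD).2 (sub_le_sub_right hx.2 _)
  have hθD : θ * (P.hi - P.lo) = inner ℝ P.normal x - P.lo := div_mul_cancel₀ _ hD.ne'
  refine ⟨(1 - θ) • a + θ • b, hC.convex ha hb (sub_nonneg.2 hθ1) hθ0 (by ring), fun c hc => ?_⟩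
  simp only [carrier, Set.mem_ofPred_eq, inner_add_right, inner_sub_right, real_inner_smul_right]
  have h1 := mul_le_mul_of_nonneg_left hρ hθ0
  have h2 := mul_le_mul_of_nonneg_left hρ (sub_nonneg.2 hθ1)
  have h3 := mul_le_mul_of_nonneg_left (h c hc).1 hρ0
  have h4 := mul_le_mul_of_nonneg_left (h c hc).2 hρ0
  constructor <;> nlinarith

theorem le_of_centers_nonempty {C : Set (E d)} (hC : IsConvexBody C) (P : Plank d) {ρ : ℝ}
    (h : (centers C P.carrier ρ).Nonempty) :
    ρ ≤ (P.hi - P.lo) / realWidth C P.normal := by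
  obtain ⟨t, ht⟩ := h
  obtain ⟨a, ha, b, hb, -, e⟩ := exists_realWidth_eq hC.isCompact hC.nonempty P.normal
  rw [le_div_iff₀ (hC.realWidth_pos P.norm_normal), e]
  have h1 := (ht b hb).2
  have h2 := (ht a ha).1
  simp only [inner_add_right, real_inner_smul_right] at h1 h2
  linarith

/-- Rounding does not change a plank while `ρ` is at most its `C`-width `ω`, so the defining
equation reads `ω = m ρ`. -/
theorem succInradius_carrier [Nontrivial (E d)] {C : Set (E d)} (hC : IsConvexBody C)
    (P : Plank d) {m : ℕ} (hm : 1 ≤ m) :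
    succInradius C P.carrier m = (P.hi - P.lo) / realWidth C P.normal / m := by
  set ω := (P.hi - P.lo) / realWidth C P.normal with hω
  have hω0 : 0 < ω := div_pos (sub_pos.2 P.lo_lt_hi) (hC.realWidth_pos P.norm_normal)
  have hm' : (1 : ℝ) ≤ m := by exact_mod_cast hm
  have hm0 : (0 : ℝ) < m := by linarith
  have hround : ∀ ρ, 0 ≤ ρ → ρ ≤ ω → roundedBody C P.carrier ρ = P.carrier := by
    intro ρ h0 h1
    refine (roundedBody_subset _ _ _).antisymm fun x hx => ?_
    obtain ⟨c, hc, h⟩ := P.exists_mem_centers hC h0 h1 hx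
    exact mem_roundedBody.2 ⟨_, h, c, hc, by simp⟩
  have hle : ω / m ≤ ω := div_le_self hω0.le hm'
  suffices h : {ρ : ℝ | 0 < ρ ∧ ρ ≤ inradius C P.carrier ∧
      minRelWidth C (roundedBody C P.carrier ρ) = ENNReal.ofReal ((m : ℝ) * ρ)} = {ω / m} by
    rw [succInradius, h, csSup_singleton]
  ext ρ
  simp only [Set.mem_ofPred_eq, Set.mem_singleton_iff]
  constructor
  · rintro ⟨hρ, -, e⟩
    have hmρ : 0 < m * ρ := by positivity
    have hne : (centers C P.carrier ρ).Nonempty := by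
      by_contra h0
      rw [roundedBody_eq_add, Set.not_nonempty_iff_eq_empty.1 h0, Set.empty_add,
        minRelWidth_empty, eq_comm, ENNReal.ofReal_eq_zero] at e
      linarith
    rw [hround ρ hρ.le (P.le_of_centers_nonempty hC hne), minRelWidth_carrier hC,
      P.relWidth_eq_ofReal hC, ENNReal.ofReal_eq_ofReal_iff hω0.le hmρ.le] at e
    rw [e]
    field_simp
  · rintro rfl
    have hp : 0 < ω / m := by positivity
    refine ⟨hp, ?_, ?_⟩
    · rw [inradius_eq]
      refine le_csSup ⟨ω, fun σ hσ => P.le_of_centers_nonempty hC hσ.2⟩ ⟨hp, ?_⟩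
      have hx : P.lo • P.normal ∈ P.carrier := by
        simp only [carrier, Set.mem_ofPred_eq, inner_smul_normal P.norm_normal]
        exact ⟨le_rfl, P.lo_lt_hi.le⟩
      obtain ⟨c, -, h⟩ := P.exists_mem_centers hC hp.le hle hx
      exact ⟨_, h⟩
    · rw [hround _ hp.le hle, minRelWidth_carrier hC, P.relWidth_eq_ofReal hC]
      congr 1
      field_simp
      exact hω.symm

end Plank

/-! ### Equivalence of the plank statements -/

theorem succPlankConjecture_iff [Nontrivial (E d)] {m : ℕ} (hm : 1 ≤ m) :
    SuccPlankConjecture d m ↔ SuccPlankWidthConjecture d m := by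
  have hm0 : (0 : ℝ) < m := by exact_mod_cast hm
  refine forall_congr' fun K => forall_congr' fun C => imp_congr_right fun hK =>
    imp_congr_right fun hC => forall_congr' fun n => forall_congr' fun P =>
    imp_congr_right fun _ => ?_
  have hnn : ∀ i, 0 ≤ ((P i).hi - (P i).lo) / realWidth C (P i).normal := fun i =>
    div_nonneg (sub_nonneg.2 (P i).lo_lt_hi.le) (hC.realWidth_pos (P i).norm_normal).le
  simp only [Plank.succInradius_carrier hC _ hm, Plank.relWidth_eq_ofReal hC]
  rw [← ENNReal.ofReal_sum_of_nonneg fun i _ => hnn i,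
    ENNReal.ofReal_le_ofReal_iff (Finset.sum_nonneg fun i _ => hnn i), ← Finset.sum_div,
    le_div_iff₀ hm0, mul_comm]

/-- In each direction the `C`-width of a plank is its `K`-width times the `C`-width of `K`, and the
latter factor is at least its minimum `w`. -/
theorem BangConjecture.bodyPlank [Nontrivial (E d)] (h : BangConjecture d) :
    BodyPlankConjecture d := by
  intro K hK n P hP C hC
  obtain ⟨u, hu, e, hmin⟩ := exists_minRelWidth_eq hC hK.isCompact hK.nonempty
  set w := realWidth K u / realWidth C u
  have hw : 0 ≤ w := (div_pos (hK.realWidth_pos hu) (hC.realWidth_pos hu)).le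
  calc minRelWidth C K = ENNReal.ofReal w * 1 := by rw [e, mul_one]
    _ ≤ ENNReal.ofReal w * ∑ i, (P i).relWidth K := by gcongr; exact h K hK n P hP
    _ = ∑ i, ENNReal.ofReal w * (P i).relWidth K := Finset.mul_sum _ _ _
    _ ≤ ∑ i, (P i).relWidth C := by
      refine Finset.sum_le_sum fun i _ => ?_
      have hKi := hK.realWidth_pos (P i).norm_normal
      have hCi := hC.realWidth_pos (P i).norm_normal
      rw [Plank.relWidth_eq_ofReal hK, Plank.relWidth_eq_ofReal hC, ← ENNReal.ofReal_mul hw]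
      apply ENNReal.ofReal_le_ofReal
      have := hmin _ (P i).norm_normal
      calc w * (((P i).hi - (P i).lo) / realWidth K (P i).normal)
          ≤ realWidth K (P i).normal / realWidth C (P i).normal *
            (((P i).hi - (P i).lo) / realWidth K (P i).normal) :=
            mul_le_mul_of_nonneg_right this
              (div_nonneg (sub_nonneg.2 (P i).lo_lt_hi.le) hKi.le)
        _ = _ := by field_simp

theorem BodyPlankConjecture.succPlankWidth [Nontrivial (E d)] (h : BodyPlankConjecture d) {m : ℕ}
    (hm : 1 ≤ m) : SuccPlankWidthConjecture d m := by
  intro K C hK hC n P hP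
  rw [← minRelWidth_roundedBody_succInradius hC hK hm]
  exact h _ (isConvexBody_roundedBody hC hK (succInradius_pos hC hK hm)
    (centers_succInradius_nonempty hC hK hm)) n P ((roundedBody_subset _ _ _).trans hP) C hC

theorem SuccPlankWidthConjecture.bang [Nontrivial (E d)] {m : ℕ} (hm : 1 ≤ m)
    (h : SuccPlankWidthConjecture d m) : BangConjecture d := by
  intro C hC n P hP
  refine le_trans ?_ (h C C hC hC n P hP)
  have hm0 : (0 : ℝ) < m := by exact_mod_cast hm
  rw [ENNReal.one_le_ofReal, ← div_le_iff₀' hm0]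
  exact one_div_le_succInradius_self hC hm

/-! ### Pieces of a slicing -/

theorem isPiece_fin_zero_iff {K Q : Set (E d)} (hK : K.Nonempty) (H : Fin 0 → Hyperplane d) :
    IsPiece K H Q ↔ Q = K := by
  constructor
  · rintro ⟨x, -, -, rfl⟩
    simp
  · rintro rfl
    obtain ⟨x, hx⟩ := hK
    exact ⟨x, hx, fun i => i.elim0, by simp⟩

namespace IsPiece

variable {k : ℕ} {K Q : Set (E d)} {H : Fin k → Hyperplane d}

theorem subset (hQ : IsPiece K H Q) : Q ⊆ K := by
  obtain ⟨x, -, -, rfl⟩ := hQ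
  exact fun y hy => hy.1

theorem isConvexBody (hK : IsConvexBody K) (hQ : IsPiece K H Q) : IsConvexBody Q := by
  obtain ⟨x, hx, hxH, rfl⟩ := hQ
  refine ⟨?_, ?_, ?_⟩
  · rintro y ⟨hy, hy'⟩ z ⟨hz, hz'⟩ a b ha hb hab
    refine ⟨hK.convex hy hz ha hb hab, fun i => ?_⟩
    rw [inner_add_right, real_inner_smul_right, real_inner_smul_right]
    have e : (inner ℝ (H i).normal x - (H i).offset) *
        (a * inner ℝ (H i).normal y + b * inner ℝ (H i).normal z - (H i).offset) =
        a * ((inner ℝ (H i).normal x - (H i).offset) *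
          (inner ℝ (H i).normal y - (H i).offset)) +
        b * ((inner ℝ (H i).normal x - (H i).offset) *
          (inner ℝ (H i).normal z - (H i).offset)) := by
      have : (H i).offset = (a + b) * (H i).offset := by rw [hab, one_mul]
      conv_lhs => rw [show ∀ p q : ℝ, p + q - (H i).offset = p + q - (a + b) * (H i).offset from
        fun p q => by rw [← this]]
      ring
    rw [e]
    exact add_nonneg (mul_nonneg ha (hy' i)) (mul_nonneg hb (hz' i))
  · have hcl : IsClosed {y : E d | ∀ i, 0 ≤ (inner ℝ (H i).normal x - (H i).offset) *
        (inner ℝ (H i).normal y - (H i).offset)} := by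
      rw [Set.ofPred_forall]
      exact isClosed_iInter fun i => isClosed_le (by fun_prop) (by fun_prop)
    exact hK.isCompact.inter_right hcl
  · have hop : IsOpen {y : E d | ∀ i, 0 < (inner ℝ (H i).normal x - (H i).offset) *
        (inner ℝ (H i).normal y - (H i).offset)} := by
      rw [Set.ofPred_forall]
      exact isOpen_iInter_of_finite fun i => isOpen_lt (by fun_prop) (by fun_prop)
    -- The point `x` may lie on the boundary of `K`, but nearby interior points are on the same open
    -- sides of all hyperplanes.
    have hcx : x ∈ closure (interior K) := by
      rw [hK.convex.closure_interior_eq_closure_of_nonempty_interior hK.interior_nonempty]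
      exact subset_closure hx
    obtain ⟨y, hy, hyK⟩ := mem_closure_iff.1 hcx _ hop fun i =>
      mul_self_pos.2 (sub_ne_zero.2 (hxH i))
    refine ⟨y, mem_interior.2 ⟨_, ?_, hop.inter isOpen_interior, hy, hyK⟩⟩
    exact fun z hz => ⟨interior_subset hz.2, fun i => (hz.1 i).le⟩

/-- Two points of a piece are not strictly separated by any of the hyperplanes. -/
theorem not_separated (hQ : IsPiece K H Q) {p q : E d} (hp : p ∈ Q) (hq : q ∈ Q) (i : Fin k)
    (hqi : inner ℝ (H i).normal q < (H i).offset) : inner ℝ (H i).normal p ≤ (H i).offset := by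
  obtain ⟨x, -, hxH, rfl⟩ := hQ
  have h1 := hp.2 i
  have h2 := hq.2 i
  by_contra! h
  rcases (hxH i).lt_or_gt with h3 | h3
  · exact absurd h1 (not_le.2 (mul_neg_of_neg_of_pos (sub_neg.2 h3) (sub_pos.2 h)))
  · exact absurd h2 (not_le.2 (mul_neg_of_pos_of_neg (sub_pos.2 h3) (sub_neg.2 hqi)))

end IsPiece

/-- A piece is determined by the vector of signs of its defining point. -/
theorem finite_isPiece {k : ℕ} (K : Set (E d)) (H : Fin k → Hyperplane d) :
    {Q | IsPiece K H Q}.Finite := by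
  refine (Set.finite_range fun σ : Fin k → SignType => {y ∈ K | ∀ i, 0 ≤
    ((σ i : ℤ) : ℝ) * (inner ℝ (H i).normal y - (H i).offset)}).subset ?_
  rintro Q ⟨x, -, hxH, rfl⟩
  refine ⟨fun i => SignType.sign (inner ℝ (H i).normal x - (H i).offset), ?_⟩
  ext y
  refine and_congr_right fun _ => forall_congr' fun i => ?_
  beta_reduce
  rcases (sub_ne_zero.2 (hxH i)).lt_or_gt with h | h
  · rw [sign_neg h, ← neg_mul_neg (inner ℝ (H i).normal x - (H i).offset),
      mul_nonneg_iff_of_pos_left (neg_pos.2 h)]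
    simp
  · rw [sign_pos h, mul_nonneg_iff_of_pos_left h]
    simp

theorem exists_isGreatest_isPiece {k : ℕ} {K : Set (E d)} {H : Fin k → Hyperplane d}
    (h : ∃ Q, IsPiece K H Q) (f : Set (E d) → ℝ) :
    ∃ ρ, IsGreatest {r : ℝ | ∃ Q, IsPiece K H Q ∧ r = f Q} ρ := by
  obtain ⟨Q, hQ, hmax⟩ := Set.exists_max_image {Q | IsPiece K H Q} f (finite_isPiece K H) h
  refine ⟨f Q, ⟨Q, hQ, rfl⟩, ?_⟩
  rintro _ ⟨Q', hQ', rfl⟩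
  exact hmax Q' hQ'

/-- A set that strictly misses all the hyperplanes lies in one piece. -/
theorem exists_isPiece_superset {k : ℕ} {K M : Set (E d)} {H : Fin k → Hyperplane d}
    (hM : M.Nonempty) (hMK : M ⊆ K)
    (h : ∀ i, (∀ y ∈ M, inner ℝ (H i).normal y < (H i).offset) ∨
      ∀ y ∈ M, (H i).offset < inner ℝ (H i).normal y) :
    ∃ Q, IsPiece K H Q ∧ M ⊆ Q := by
  obtain ⟨x, hx⟩ := hM
  refine ⟨_, ⟨x, hMK hx, fun i => ?_, rfl⟩, fun y hy => ⟨hMK hy, fun i => ?_⟩⟩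
  · rcases h i with h | h
    · exact (h x hx).ne
    · exact (h x hx).ne'
  · rcases h i with h | h
    · exact mul_nonneg_of_nonpos_of_nonpos (sub_nonpos.2 (h x hx).le) (sub_nonpos.2 (h y hy).le)
    · exact mul_nonneg (sub_nonneg.2 (h x hx).le) (sub_nonneg.2 (h y hy).le)

/-! ### From planks to cuts: a piece with large inradius -/

/-- Bang's conjecture, in real numbers. -/
theorem BangConjecture.exists_notMem (h : BangConjecture d) {T : Set (E d)} (hT : IsConvexBody T)
    {n : ℕ} (P : Fin n → Plank d)
    (hP : ∑ i, ((P i).hi - (P i).lo) / realWidth T (P i).normal < 1) :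
    ∃ x ∈ T, ∀ i, x ∉ (P i).carrier := by
  by_contra! hcov
  have := h T hT n P fun x hx => Set.mem_iUnion.2 (hcov x hx)
  simp only [Plank.relWidth_eq_ofReal hT] at this
  rw [← ENNReal.ofReal_sum_of_nonneg fun i _ => div_nonneg (sub_nonneg.2 (P i).lo_lt_hi.le)
    (hT.realWidth_pos (P i).norm_normal).le, ENNReal.one_le_ofReal] at this
  linarith

/-- The strict inequality on `s` gives `T` interior points and makes the total plank width strictly
less than 1, so that Bang's statement yields an uncovered point of `T`. -/
theorem BangConjecture.exists_piece_le_succInradius [Nontrivial (E d)] (hB : BangConjecture d)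
    {K C : Set (E d)} (hK : IsConvexBody K) (hC : IsConvexBody C) {m n : ℕ} (hm : 1 ≤ m)
    (hn : 1 ≤ n) (H : Fin (n - 1) → Hyperplane d) {s : ℝ} (hs : 0 < s)
    (hlt : s < succInradius C K (m * n)) :
    ∃ Q, IsPiece K H Q ∧ s ≤ succInradius C Q m := by
  -- Without hyperplanes the only piece is `K`; for `n ≥ 2` both `n - 1` and `N = m n - 1` are
  -- positive.
  rcases hn.eq_or_lt with rfl | hn2
  · rw [mul_one] at hlt
    exact ⟨K, (isPiece_fin_zero_iff hK.nonempty H).2 rfl, hlt.le⟩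
  have hm' : (1 : ℝ) ≤ m := by exact_mod_cast hm
  have hn' : (1 : ℝ) < n := by exact_mod_cast hn2
  have hmn : 1 ≤ m * n := Nat.mul_pos hm hn
  set ρ := succInradius C K (m * n) with hρ
  obtain ⟨-, hρne, hρw⟩ := (isGreatest_succInradius hC hK hmn).1
  rw [← hρ] at hρne hρw
  obtain ⟨t₀, ht₀⟩ := hρne
  set N : ℝ := m * n - 1 with hN
  have hN0 : 0 < N := by nlinarith
  set T := centers C K s with hT
  have hTc : IsCompact T := isCompact_centers hC.nonempty hK.isCompact s
  have hTb : IsConvexBody T := by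
    refine (hC.vadd_smul t₀ (sub_pos.2 hlt)).of_subset (convex_centers C hK.convex s) hTc ?_
    rintro _ ⟨_, ⟨c, hc, rfl⟩, rfl⟩
    exact add_smul_mem_centers hC.convex hs.le hlt.le ht₀ hc
  have hTw : ∀ u : E d, ‖u‖ = 1 → N * s * realWidth C u < realWidth T u := by
    intro u hu
    obtain ⟨c, hc⟩ := hC.nonempty
    have hρc := isCompact_centers hC.nonempty hK.isCompact ρ
    obtain ⟨a, ha, b, hb, -, e⟩ := exists_realWidth_eq hρc ⟨t₀, ht₀⟩ u
    have h1 := inner_sub_inner_le_realWidth hTc u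
      (add_smul_mem_centers hC.convex hs.le hlt.le hb hc)
      (add_smul_mem_centers hC.convex hs.le hlt.le ha hc)
    have h2 := hρw u hu
    simp only [inner_add_right] at h1
    push_cast at h2
    have h3 : N * s * realWidth C u < N * ρ * realWidth C u :=
      mul_lt_mul_of_pos_right (mul_lt_mul_of_pos_left hlt hN0) (hC.realWidth_pos hu)
    linarith
  -- The width of `T` exceeds `N s` times that of `C`, so this `l` makes `l T` at least `(m - 1) s`
  -- times as wide as `C`, as centers in the final piece must be.
  set l : ℝ := (m - 1) / N with hl
  have hl0 : 0 ≤ l := div_nonneg (sub_nonneg.2 hm') hN0.le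
  have hlN : l * N = m - 1 := div_mul_cancel₀ _ hN0.ne'
  have hl1 : (1 - l) * N = m * (n - 1) := by rw [sub_mul, hlN, hN]; ring
  have hl1' : 0 < 1 - l := by
    refine pos_of_mul_pos_left ?_ hN0.le
    rw [hl1]
    exact mul_pos (by linarith) (by linarith)
  set L : Set (E d) := l • T + s • C with hL
  have hlT : (l • T).Nonempty := hTb.nonempty.smul_set
  have hsC : (s • C).Nonempty := hC.nonempty.smul_set
  have hLc : IsCompact L := (hTc.smul l).add (hC.isCompact.smul s)
  have hLne : L.Nonempty := hlT.add hsC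
  have hLw : ∀ u, realWidth L u = l * realWidth T u + s * realWidth C u := by
    intro u
    rw [hL, realWidth_add (hTc.smul l) (hC.isCompact.smul s) hlT hsC,
      realWidth_smul hTc hTb.nonempty hl0, realWidth_smul hC.isCompact hC.nonempty hs.le]
  choose a ha b hb hab e using fun i => exists_realWidth_eq hLc hLne (H i).normal
  have hpos : ∀ i, 0 < realWidth L (H i).normal := by
    intro i
    rw [hLw]
    have h1 := hTb.realWidth_pos (H i).norm_normal
    have h2 := hC.realWidth_pos (H i).norm_normal
    positivity
  -- The plank of those `τ` for which the hyperplane `H i` meets `(1 - l) τ + L`.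
  let P : Fin (n - 1) → Plank d := fun i =>
    { normal := (H i).normal
      norm_normal := (H i).norm_normal
      lo := ((H i).offset - inner ℝ (H i).normal (b i)) / (1 - l)
      hi := ((H i).offset - inner ℝ (H i).normal (a i)) / (1 - l)
      lo_lt_hi := div_lt_div_of_pos_right (by linarith [hpos i, e i]) hl1' }
  obtain ⟨τ, hτ, hτP⟩ := hB.exists_notMem hTb P (by
    -- The `T`-width of each plank is below `(l + 1/N)/(1 - l) = (m/N)/(m (n - 1)/N)`; after
    -- clearing denominators this is the bound `hTw`.
    have hterm : ∀ i, ((P i).hi - (P i).lo) / realWidth T (P i).normal < 1 / (n - 1) := by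
      intro i
      have h1 := hTb.realWidth_pos (H i).norm_normal
      have h2 := hTw _ (H i).norm_normal
      have h3 := hLw (H i).normal
      have h4 : (P i).hi - (P i).lo = realWidth L (H i).normal / (1 - l) := by
        simp only [P]
        rw [e i]
        ring
      rw [h4, h3, div_div, div_lt_div_iff₀ (mul_pos hl1' h1) (by linarith)]
      refine lt_of_mul_lt_mul_right ?_ hN0.le
      have h5 : 1 * ((1 - l) * realWidth T (H i).normal) * N =
          (n - 1) * (m * realWidth T (H i).normal) := by
        linear_combination realWidth T (H i).normal * hl1
      have h6 : (l * realWidth T (H i).normal + s * realWidth C (H i).normal) * (n - 1) * N =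
          (n - 1) * ((m - 1) * realWidth T (H i).normal + N * s * realWidth C (H i).normal) := by
        linear_combination (n - 1) * realWidth T (H i).normal * hlN
      rw [h5, h6]
      refine mul_lt_mul_of_pos_left ?_ (by linarith)
      linarith
    have : Nonempty (Fin (n - 1)) := ⟨⟨0, by omega⟩⟩
    calc ∑ i, ((P i).hi - (P i).lo) / realWidth T (P i).normal
        < ∑ _i : Fin (n - 1), 1 / ((n : ℝ) - 1) :=
          Finset.sum_lt_sum_of_nonempty Finset.univ_nonempty fun i _ => hterm i
      _ = 1 := by
        rw [Finset.sum_const, Finset.card_univ, Fintype.card_fin, nsmul_eq_mul,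
          Nat.cast_sub hn, Nat.cast_one, mul_one_div_cancel (by linarith)])
  set t := (1 - l) • τ with ht
  -- By convexity `t + l T ⊆ T`, hence `t + L ⊆ T + s C ⊆ K`.
  have hcen : ∀ x ∈ T, t + l • x ∈ T := fun x hx =>
    hTb.convex hτ hx hl1'.le hl0 (by ring)
  obtain ⟨Q, hQ, hsub⟩ := exists_isPiece_superset (K := K) (M := (fun y => t + y) '' L) (H := H)
    (hLne.image _) (by
      rintro _ ⟨_, ⟨_, ⟨x, hx, rfl⟩, _, ⟨c, hc, rfl⟩, rfl⟩, rfl⟩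
      simp only [← add_assoc]
      exact hcen x hx c hc) (by
      intro i
      have h1 : inner ℝ (H i).normal t = (1 - l) * inner ℝ (H i).normal τ := by
        rw [ht, real_inner_smul_right]
      have h2 := hτP i
      simp only [Plank.carrier, Set.mem_ofPred_eq, not_and_or, not_le, P] at h2
      rw [lt_div_iff₀ hl1', div_lt_iff₀ hl1'] at h2
      refine h2.imp ?_ ?_
      · rintro h _ ⟨y, hy, rfl⟩
        simp only [inner_add_right]
        linarith [(hab i y hy).2]
      · rintro h _ ⟨y, hy, rfl⟩
        simp only [inner_add_right]
        linarith [(hab i y hy).1])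
  have hQb := hQ.isConvexBody hK
  have hcQ : ∀ x ∈ T, t + l • x ∈ centers C Q s := by
    intro x hx c hc
    rw [add_assoc]
    exact hsub ⟨_, Set.add_mem_add (Set.smul_mem_smul_set hx) (Set.smul_mem_smul_set hc), rfl⟩
  refine ⟨Q, hQ, (isGreatest_succInradius hC hQb hm).2
    ⟨hs.le, ⟨_, hcQ τ hτ⟩, fun u hu => ?_⟩⟩
  obtain ⟨p, hp, q, hq, -, e'⟩ := exists_realWidth_eq hTc hTb.nonempty u
  have h1 := inner_sub_inner_le_realWidth (isCompact_centers hC.nonempty hQb.isCompact s) u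
    (hcQ q hq) (hcQ p hp)
  simp only [inner_add_right, real_inner_smul_right] at h1
  have h2 := mul_le_mul_of_nonneg_left (hTw u hu).le hl0
  have h3 : l * (N * s * realWidth C u) = (m - 1) * s * realWidth C u := by
    linear_combination s * realWidth C u * hlN
  rw [e'] at h2
  linarith

/-! ### An optimal slicing and the cutting statements -/

/-- Two numbers of `[0, n δ]` more than `δ` apart are strictly separated by one of
`δ, 2 δ, …, (n - 1) δ`. -/
theorem exists_separating_multiple {δ x y : ℝ} (hδ : 0 < δ) {n : ℕ} (hx : 0 ≤ x)
    (hy : y ≤ n * δ) (hxy : x + δ < y) :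
    ∃ j : Fin (n - 1), x < ((j : ℕ) + 1) * δ ∧ ((j : ℕ) + 1) * δ < y := by
  have h1 := Nat.floor_le (div_nonneg hx hδ.le)
  have h2 := Nat.lt_floor_add_one (x / δ)
  rw [le_div_iff₀ hδ] at h1
  rw [div_lt_iff₀ hδ] at h2
  have h3 : ((⌊x / δ⌋₊ : ℝ) + 1) * δ < y := by linarith
  have h4 : ⌊x / δ⌋₊ + 1 < n := by
    have := lt_of_mul_lt_mul_right (h3.trans_le hy) hδ.le
    exact_mod_cast this
  exact ⟨⟨⌊x / δ⌋₊, by omega⟩, h2, h3⟩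

/-- Slicing the rounded body into slabs of equal width in a direction of minimal width. -/
theorem exists_slicing_succInradius_le [Nontrivial (E d)] {K C : Set (E d)} (hK : IsConvexBody K)
    (hC : IsConvexBody C) {m n : ℕ} (hm : 1 ≤ m) (hn : 1 ≤ n) :
    ∃ H : Fin (n - 1) → Hyperplane d, ∀ Q, IsPiece K H Q →
      succInradius C Q m ≤ succInradius C K (m * n) := by
  have hm' : (1 : ℝ) ≤ m := by exact_mod_cast hm
  have hmn : 1 ≤ m * n := Nat.mul_pos hm hn
  have hs := succInradius_pos hC hK hmn
  have hg := isGreatest_succInradius hC hK hmn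
  obtain ⟨u, hu, hw⟩ := exists_realWidth_eq_of_isGreatest_wideFactors hC hK
    (sub_nonneg.2 (by exact_mod_cast hmn)) hg
  set s := succInradius C K (m * n)
  have hRc := isCompact_roundedBody hC hK.isCompact s
  have hRw := realWidth_roundedBody hC hK.isCompact hs.le hg.1.2.1 u
  obtain ⟨a, -, b, -, hab, e⟩ := exists_realWidth_eq hRc (roundedBody_nonempty hC hg.1.2.1) u
  have hCu := hC.realWidth_pos hu
  -- The rounded body has width `m n s` times that of `C` along `u`, so it splits into `n` slabs of
  -- width `δ`.
  set δ := m * s * realWidth C u with hδ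
  have hδ0 : 0 < δ := by positivity
  have hba : inner ℝ u b = inner ℝ u a + n * δ := by
    rw [hw, e] at hRw
    push_cast at hRw
    linear_combination hRw
  refine ⟨fun j => ⟨u, hu, inner ℝ u a + ((j : ℕ) + 1) * δ⟩, fun Q hQ => ?_⟩
  by_contra! hlt
  have hQb := hQ.isConvexBody hK
  obtain ⟨⟨hσ, hne, hwide⟩, -⟩ := isGreatest_succInradius hC hQb hm
  set σ := succInradius C Q m
  obtain ⟨q, hq, p, hp, -, epq⟩ := exists_realWidth_eq
    (isCompact_roundedBody hC hQb.isCompact σ) (roundedBody_nonempty hC hne) u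
  rw [realWidth_roundedBody hC hQb.isCompact hσ hne] at epq
  -- If `σ > s`, the rounded body of `Q` fits between the extreme levels, yet is wider than one
  -- slab; a hyperplane then strictly separates two points of `Q`.
  have hsub : roundedBody C Q σ ⊆ roundedBody C K s :=
    (roundedBody_mono C hQ.subset σ).trans (roundedBody_anti hC.convex K hs.le hlt.le)
  have hδσ : δ < inner ℝ u p - inner ℝ u q := by
    have h1 : m * s * realWidth C u < m * σ * realWidth C u :=
      mul_lt_mul_of_pos_right (mul_lt_mul_of_pos_left hlt (by linarith)) hCu
    linarith [hwide u hu]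
  obtain ⟨j, hj1, hj2⟩ := exists_separating_multiple hδ0 (x := inner ℝ u q - inner ℝ u a)
    (y := inner ℝ u p - inner ℝ u a) (n := n) (sub_nonneg.2 (hab q (hsub hq)).1)
    (by linarith [(hab p (hsub hp)).2]) (by linarith)
  have := hQ.not_separated (roundedBody_subset _ _ _ hp) (roundedBody_subset _ _ _ hq) j
    (by simp only; linarith)
  simp only at this
  linarith

/-- Letting `s` tend to `r_C(K, mn)` gives the lower bound for every slicing; the equal slabs attain
it. -/
theorem BangConjecture.succCut [Nontrivial (E d)] (hB : BangConjecture d) {m : ℕ} (hm : 1 ≤ m) :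
    SuccCutConjecture d m := by
  intro K C hK hC n hn
  have hs := succInradius_pos hC hK (Nat.mul_pos hm hn)
  have hlow : ∀ (H : Fin (n - 1) → Hyperplane d) (ρ : ℝ),
      IsGreatest {r : ℝ | ∃ Q, IsPiece K H Q ∧ r = succInradius C Q m} ρ →
      succInradius C K (m * n) ≤ ρ := by
    intro H ρ hρ
    have hstep : ∀ s, 0 < s → s < succInradius C K (m * n) → s ≤ ρ := by
      intro s h0 h1
      obtain ⟨Q, hQ, h⟩ := hB.exists_piece_le_succInradius hK hC hm hn H h0 h1
      exact h.trans (hρ.2 ⟨Q, hQ, rfl⟩)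
    have hρ0 : 0 < ρ := (half_pos hs).trans_le (hstep _ (half_pos hs) (half_lt_self hs))
    by_contra! h
    have := hstep ((ρ + succInradius C K (m * n)) / 2) (by linarith) (by linarith)
    linarith
  refine ⟨?_, fun ρ ⟨H, hρ⟩ => hlow H ρ hρ⟩
  obtain ⟨H, hH⟩ := exists_slicing_succInradius_le hK hC hm hn
  obtain ⟨Q₀, hQ₀, -⟩ := hB.exists_piece_le_succInradius hK hC hm hn H (half_pos hs)
    (half_lt_self hs)
  obtain ⟨ρ, hρ⟩ := exists_isGreatest_isPiece ⟨Q₀, hQ₀⟩ fun Q => succInradius C Q m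
  refine ⟨H, ?_⟩
  obtain ⟨Q, hQ, e⟩ := hρ.1
  rwa [(hlow H ρ hρ).antisymm (e ▸ hH Q hQ)]

theorem SuccCutConjecture.bodyCut [Nontrivial (E d)] (h : SuccCutConjecture d 1) :
    BodyCutConjecture d := by
  intro K C hK hC n hn
  have := h K C hK hC n hn
  rw [one_mul] at this
  have e : ∀ (H : Fin (n - 1) → Hyperplane d) (r : ℝ) (Q : Set (E d)),
      (IsPiece K H Q ∧ r = succInradius C Q 1) ↔ (IsPiece K H Q ∧ r = inradius C Q) :=
    fun H r Q => and_congr_right fun hQ => by rw [succInradius_one hC (hQ.isConvexBody hK)]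
  simpa only [e] using this

theorem exists_isPiece {k : ℕ} {K : Set (E d)} (hK : IsConvexBody K) (H : Fin k → Hyperplane d) :
    ∃ Q, IsPiece K H Q := by
  have hd : Dense (⋂ i, {x : E d | inner ℝ (H i).normal x ≠ (H i).offset}) := by
    refine dense_iInter_of_isOpen (fun i => isOpen_ne_fun (by fun_prop) (by fun_prop)) fun i => ?_
    refine Metric.dense_iff.2 fun x r hr => ?_
    by_cases hx : inner ℝ (H i).normal x = (H i).offset
    · refine ⟨x + (r / 2) • (H i).normal, ?_, ?_⟩
      · rw [Metric.mem_ball, dist_eq_norm, add_sub_cancel_left, norm_smul, (H i).norm_normal,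
          mul_one, Real.norm_of_nonneg (by positivity)]
        linarith
      · simp only [Set.mem_ofPred_eq, inner_add_right, inner_smul_normal (H i).norm_normal, hx]
        linarith
    · exact ⟨x, Metric.mem_ball_self hr, hx⟩
  obtain ⟨x, hx, hxH⟩ := hd.inter_open_nonempty _ isOpen_interior hK.interior_nonempty
  exact ⟨_, x, interior_subset hx, fun i => Set.mem_iInter.1 hxH i, rfl⟩

/-- Taking `K = C`, the bound `r_C(C, n) ≥ 1/n` yields a piece of inradius at least `1/n`; a copy of
that size contains the smaller one. -/
theorem BodyCutConjecture.alexanderDavenport [Nontrivial (E d)] (h : BodyCutConjecture d) :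
    AlexanderDavenportConjecture d := by
  intro C hC n hn H
  obtain ⟨ρ, hρ⟩ := exists_isGreatest_isPiece (exists_isPiece hC H) (inradius C)
  have h1 := (one_div_le_succInradius_self hC hn).trans ((h C C hC hC n hn).2 ⟨H, hρ⟩)
  obtain ⟨Q, hQ, e⟩ := hρ.1
  have hQb := hQ.isConvexBody hC
  obtain ⟨t, ht⟩ := centers_succInradius_nonempty hC hQb le_rfl
  rw [succInradius_one hC hQb, ← e] at ht
  obtain ⟨c, hc⟩ := hC.nonempty
  exact ⟨Q, hQ, _, vadd_smul_subset_iff.2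
    (add_smul_mem_centers hC.convex (by positivity) h1 ht hc)⟩

/-! ### From cuts back to planks -/

/-- If a translate of `r C` lies in the compact convex set `C`, then its translation vector lies in
`(1 - r) C`. -/
theorem exists_eq_smul_of_mem_centers {C : Set (E d)} (hC : IsConvexBody C) {r : ℝ} (hr : r < 1)
    {t : E d} (ht : t ∈ centers C C r) : ∃ x ∈ C, t = (1 - r) • x := by
  have h1 : 0 < 1 - r := sub_pos.2 hr
  refine ⟨(1 - r)⁻¹ • t, ?_, (smul_inv_smul₀ h1.ne' t).symm⟩
  -- A functional separating `t / (1 - r)` from `C` would take a larger value at `t + r c` than at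
  -- its maximizer `c` on `C`.
  by_contra hx
  obtain ⟨f, v, hf, hv⟩ := geometric_hahn_banach_closed_point hC.convex hC.isCompact.isClosed hx
  obtain ⟨c, hc, hmax⟩ := hC.isCompact.exists_isMaxOn hC.nonempty f.continuous.continuousOn
  have h2 : f (t + r • c) ≤ f c := hmax (ht c hc)
  have h3 := hf c hc
  rw [map_smul, smul_eq_mul, ← div_eq_inv_mul, lt_div_iff₀ h1] at hv
  rw [map_add, map_smul, smul_eq_mul] at h2
  nlinarith

/-- Any two points of `[0, L]` at distance `δ` enclose one of finitely many suitable levels. -/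
theorem exists_levels {L δ : ℝ} {k : ℕ} (hL : 0 ≤ L) (hk : L < k * δ) :
    ∃ ξ : Fin k → ℝ, ∀ τ, 0 ≤ τ → τ ≤ L → ∃ j, τ < ξ j ∧ ξ j < τ + δ := by
  have hk0 : (0 : ℝ) < k := by
    rcases Nat.eq_zero_or_pos k with rfl | h
    · rw [Nat.cast_zero, zero_mul] at hk
      linarith
    · exact_mod_cast h
  -- The levels are multiples of `η` with `L/k < η < δ`: `k` of them reach beyond `L`, and
  -- consecutive ones are less than `δ` apart.
  obtain ⟨η, h1, h2⟩ := exists_between ((div_lt_iff₀' hk0).2 hk)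
  have hη : 0 < η := (div_nonneg hL hk0.le).trans_lt h1
  rw [div_lt_iff₀' hk0] at h1
  refine ⟨fun j => ((j : ℕ) + 1) * η, fun τ h0 hτ => ?_⟩
  have h3 := Nat.floor_le (div_nonneg h0 hη.le)
  have h4 := Nat.lt_floor_add_one (τ / η)
  rw [le_div_iff₀ hη] at h3
  rw [div_lt_iff₀ hη] at h4
  refine ⟨⟨⌊τ / η⌋₊, (Nat.floor_lt (div_nonneg h0 hη.le)).2 ?_⟩, h4, ?_⟩
  · rw [div_lt_iff₀ hη]
    linarith
  · simp only
    linarith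

theorem AlexanderDavenportConjecture.bang (h : AlexanderDavenportConjecture d) :
    BangConjecture d := by
  intro C hC n P hP
  by_contra! hlt
  set w : Fin n → ℝ := fun i => ((P i).hi - (P i).lo) / realWidth C (P i).normal with hw
  have hw0 : ∀ i, 0 ≤ w i := fun i =>
    div_nonneg (sub_nonneg.2 (P i).lo_lt_hi.le) (hC.realWidth_pos (P i).norm_normal).le
  simp only [Plank.relWidth_eq_ofReal hC] at hlt
  rw [← ENNReal.ofReal_sum_of_nonneg fun i _ => hw0 i, ENNReal.ofReal_lt_one] at hlt
  -- `M` is so large that replacing each `M w i` by the integer `k i` above it, at a cost of at most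
  -- 1 per plank, keeps the sum at most `M`.
  obtain ⟨M, hM⟩ := exists_nat_ge ((n : ℝ) / (1 - ∑ i, w i))
  rw [div_le_iff₀ (sub_pos.2 hlt)] at hM
  let k : Fin n → ℕ := fun i => ⌊M * w i⌋₊ + 1
  have hk1 : ∀ i, M * w i < k i := fun i => by
    simpa [k] using Nat.lt_floor_add_one (M * w i)
  have hk : ∑ i, k i ≤ M := by
    have : (∑ i, (k i : ℝ)) ≤ M := by
      calc (∑ i, (k i : ℝ)) ≤ ∑ i, (M * w i + 1) := by
            refine Finset.sum_le_sum fun i _ => ?_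
            simpa [k] using Nat.floor_le (mul_nonneg M.cast_nonneg (hw0 i))
        _ = M * ∑ i, w i + n := by simp [Finset.sum_add_distrib, Finset.mul_sum]
        _ ≤ M := by linarith
    exact_mod_cast this
  obtain ⟨x₀, hx₀⟩ := hC.nonempty
  obtain ⟨i₀, -⟩ := Set.mem_iUnion.1 (hP hx₀)
  have hM0 : 0 < M := by
    have h1 : k i₀ ≤ ∑ i, k i := Finset.single_le_sum (fun _ _ => Nat.zero_le _)
      (Finset.mem_univ i₀)
    have h2 : 1 ≤ k i₀ := Nat.le_add_left _ _
    omega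
  have hMr : (0 : ℝ) < M := by exact_mod_cast hM0
  set r : ℝ := 1 / ((M + 1 : ℕ) : ℝ) with hr
  have hr0 : 0 < r := by positivity
  have hrM : r * (M + 1) = 1 := by rw [hr]; push_cast; field_simp
  have hr1 : r < 1 := by nlinarith
  choose a ha b hb hab e using fun i =>
    exists_realWidth_eq hC.isCompact hC.nonempty (P i).normal
  have hlev : ∀ i, ∃ ξ : Fin (k i) → ℝ, ∀ τ, 0 ≤ τ → τ ≤ (1 - r) * ((P i).hi - (P i).lo) →
      ∃ j, τ < ξ j ∧ ξ j < τ + r * realWidth C (P i).normal := by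
    intro i
    have hwi := hC.realWidth_pos (P i).norm_normal
    refine exists_levels (mul_nonneg (sub_nonneg.2 hr1.le) (sub_nonneg.2 (P i).lo_lt_hi.le)) ?_
    have h1 : (P i).hi - (P i).lo = w i * realWidth C (P i).normal :=
      (div_mul_cancel₀ _ hwi.ne').symm
    have h2 : 1 - r = r * M := by linarith
    rw [h1, h2]
    calc r * M * (w i * realWidth C (P i).normal)
        = (M * w i) * (r * realWidth C (P i).normal) := by ring
      _ < k i * (r * realWidth C (P i).normal) :=
        mul_lt_mul_of_pos_right (hk1 i) (mul_pos hr0 hwi)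
  choose ξ hξ using hlev
  -- This offset makes the hyperplane cut `t + r C` strictly exactly when the level lies strictly
  -- between the height of `t` above `(1 - r) lo` and that height plus the width of `r C`.
  let G : (Σ i, Fin (k i)) → Hyperplane d := fun p =>
    { normal := (P p.1).normal
      norm_normal := (P p.1).norm_normal
      offset := (1 - r) * (P p.1).lo + r * inner ℝ (P p.1).normal (a p.1) + ξ p.1 p.2 }
  obtain ⟨φ⟩ : Nonempty ((Σ i, Fin (k i)) ↪ Fin (M + 1 - 1)) :=
    Function.Embedding.nonempty_of_card_le (by simpa using hk)
  -- Unused indices receive an arbitrary hyperplane, since further cuts do no harm.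
  let H : Fin (M + 1 - 1) → Hyperplane d :=
    Function.extend φ G fun _ => ⟨(P i₀).normal, (P i₀).norm_normal, 0⟩
  obtain ⟨Q, hQ, t, ht⟩ := h C hC (M + 1) (Nat.le_add_left _ _) H
  rw [vadd_smul_subset_iff, ← hr] at ht
  -- The translation vector is `(1 - r) x` with `x` in some plank `P i`, so its height ranges over
  -- an interval of length `(1 - r)(hi - lo)`, where the levels `ξ i` are dense enough to cut the
  -- copy.
  obtain ⟨x, hx, hxt⟩ := exists_eq_smul_of_mem_centers hC hr1 fun c hc => hQ.subset (ht c hc)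
  obtain ⟨i, hi⟩ := Set.mem_iUnion.1 (hP hx)
  have hti : inner ℝ (P i).normal t = (1 - r) * inner ℝ (P i).normal x := by
    rw [hxt, real_inner_smul_right]
  have hr1' : 0 ≤ 1 - r := sub_nonneg.2 hr1.le
  obtain ⟨j, hj1, hj2⟩ := hξ i (inner ℝ (P i).normal t - (1 - r) * (P i).lo)
    (by rw [hti, ← mul_sub]; exact mul_nonneg hr1' (sub_nonneg.2 hi.1))
    (by rw [hti, ← mul_sub]; exact mul_le_mul_of_nonneg_left (sub_le_sub_right hi.2 _) hr1')
  have hH : H (φ ⟨i, j⟩) = G ⟨i, j⟩ := φ.injective.extend_apply _ _ _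
  have hsep := hQ.not_separated (ht _ (hb i)) (ht _ (ha i)) (φ ⟨i, j⟩)
  rw [hH] at hsep
  simp only [G, inner_add_right, real_inner_smul_right] at hsep
  have := hsep (by linarith)
  rw [e i] at hj2
  linarith

end PlankInradii

/-! ### The equivalences assembled -/

theorem mainTheorem4 (d : ℕ) (hd : 2 ≤ d) :
    List.TFAE [
      PlankInradii.BangConjecture d,
      PlankInradii.AlexanderDavenportConjecture d,
      PlankInradii.BodyPlankConjecture d,
      PlankInradii.BodyCutConjecture d,
      ∀ m : ℕ, 1 ≤ m → PlankInradii.SuccPlankConjecture d m,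
      ∀ m : ℕ, 1 ≤ m → PlankInradii.SuccPlankWidthConjecture d m,
      ∀ m : ℕ, 1 ≤ m → PlankInradii.SuccCutConjecture d m] ∧
    ∀ m : ℕ, 1 ≤ m →
      (PlankInradii.SuccPlankConjecture d m ↔ PlankInradii.SuccPlankWidthConjecture d m) ∧
      (PlankInradii.SuccPlankConjecture d m → PlankInradii.SuccCutConjecture d m) := by
  have : Nonempty (Fin d) := ⟨⟨0, by omega⟩⟩
  have : Nontrivial (PlankInradii.E d) := inferInstance
  refine ⟨?_, fun m hm => ⟨PlankInradii.succPlankConjecture_iff hm, fun h =>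
    (((PlankInradii.succPlankConjecture_iff hm).1 h).bang hm).succCut hm⟩⟩
  tfae_have 1 → 3 := fun h => h.bodyPlank
  tfae_have 3 → 6 := fun h m hm => h.succPlankWidth hm
  tfae_have 6 → 1 := fun h => (h 1 le_rfl).bang le_rfl
  tfae_have 5 ↔ 6 := forall₂_congr fun m hm => PlankInradii.succPlankConjecture_iff hm
  tfae_have 1 → 7 := fun h m hm => h.succCut hm
  tfae_have 7 → 4 := fun h => (h 1 le_rfl).bodyCut
  tfae_have 4 → 2 := fun h => h.alexanderDavenport
  tfae_have 2 → 1 := fun h => h.bang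
  tfae_finish
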